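/- Let $p$ be a prime and $n\ge 1$, and let $\mathcal A$ be the mod-$p$ Steenrod algebra. Let $D_n=\mathbb F_p[y_1,\dots,y_n]^{GL_n(\mathbb F_p)}$ be the classical Dickson algebra, where $|y_i|=2$ if $p$ is odd and $|y_i|=1$ if $p=2$; it is a graded $\mathcal A$-module through the action of $\mathcal A$ on $\mathbb F_p[y_1,\dots,y_n]\subseteq H^*((B\mathbb Z/p)^n;\mathbb F_p)$ (for $p$ odd the Bockstein acts as zero). Let $d_{n,1},\dots,d_{n,n}\in D_n$ be the Dickson invariants, determined by $\prod_{v}(X-v)=\sum_{i=0}^n(-1)^i d_{n,i}X^{p^{n-i}}$ (with $d_{n,0}=1$), the product being over all linear forms $v$ in $y_1,\dots,y_n$ over $\mathbb F_p$; thus $|d_{n,i}|=2(p^n-p^{n-i})$, resp. $2^n-2^{n-i}$ if $p=2$. Let $\overline{D_n}\subset D_n$ be the augmentation ideal (the invariants without constant term). (1) Let $f:D_n\to D_n$ be an $\mathcal A$-linear map of degree $0$ with $f(d_{n,1})\ne 0$. Then $f$ restricts to an isomorphism $\overline{D_n}\to\overline{D_n}$; moreover, $f$ is an isomorphism of $D_n$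 if and only if $f(1)\neq 0$. (2) Hence the classical Dickson algebra is atomic, in the following sense: every degree-preserving $\mathcal A$-linear map $\overline{D_n}\to\overline{D_n}$ which is an isomorphism on the lowest positive degree in which $\overline{D_n}$ is nonzero is an isomorphism. -/

import Mathlib

open Polynomial

namespace Dickson

/-! ### The mod `p` Steenrod algebra -/

/-- Generators of the mod `p` Steenrod algebra: the Bockstein `β` and the operations `P^k`
(for `p = 2`, `P^k` is the Steenrod square `Sq^k`). -/
inductive SteenrodGen : Type
  | bockstein : SteenrodGen
  | power (k : ℕ) : SteenrodGen

/-- `β` in the free algebra. -/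
def freeBockstein (p : ℕ) : FreeAlgebra (ZMod p) SteenrodGen :=
  FreeAlgebra.ι (ZMod p) SteenrodGen.bockstein

/-- `P^k` in the free algebra. -/
def freePower (p k : ℕ) : FreeAlgebra (ZMod p) SteenrodGen :=
  FreeAlgebra.ι (ZMod p) (SteenrodGen.power k)

/-- The defining relations of the mod `p` Steenrod algebra: `P^0 = 1`, the Adem relations, and, for
odd `p`, `β² = 0` and the Adem relations with a Bockstein. For `p = 2` the relation `adem` reads
`Sq^a Sq^b = ∑ j, C(b-j-1, a-2j) Sq^(a+b-j) Sq^j` for `a < 2b`, and `β = Sq^1`. -/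
inductive SteenrodRel (p : ℕ) :
    FreeAlgebra (ZMod p) SteenrodGen → FreeAlgebra (ZMod p) SteenrodGen → Prop
  | power_zero : SteenrodRel p (freePower p 0) 1
  | adem (a b : ℕ) (hab : a < p * b) :
      SteenrodRel p (freePower p a * freePower p b)
        (∑ j ∈ Finset.range (a + 1) with p * j ≤ a,
          ((-1 : ZMod p) ^ (a + j) * (((p - 1) * (b - j) - 1).choose (a - p * j) : ZMod p)) •
            (freePower p (a + b - j) * freePower p j))
  | bockstein_sq (hp : p ≠ 2) : SteenrodRel p (freeBockstein p * freeBockstein p) 0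
  | adem_bockstein (hp : p ≠ 2) (a b : ℕ) (hab : a ≤ p * b) :
      SteenrodRel p (freePower p a * freeBockstein p * freePower p b)
        ((∑ j ∈ Finset.range (a + 1) with p * j ≤ a,
          ((-1 : ZMod p) ^ (a + j) * (((p - 1) * (b - j)).choose (a - p * j) : ZMod p)) •
            (freeBockstein p * freePower p (a + b - j) * freePower p j)) +
        ∑ j ∈ Finset.range (a + 1) with p * j + 1 ≤ a,
          ((-1 : ZMod p) ^ (a + j + 1) *
            (((p - 1) * (b - j) - 1).choose (a - p * j - 1) : ZMod p)) •
            (freePower p (a + b - j) * freeBockstein p * freePower p j))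
  | bockstein_two (hp : p = 2) : SteenrodRel p (freeBockstein p) (freePower p 1)

/-- The mod `p` Steenrod algebra `𝒜`. -/
abbrev SteenrodAlgebra (p : ℕ) : Type := RingQuot (SteenrodRel p)

/-! ### Reduced powers on polynomial algebras -/

section Powers

variable (p : ℕ) [Fact p.Prime] (σ : Type*)

/-- The total operation `∑ P^k t^k`: the algebra homomorphism with `y ↦ y + y^p t` on each
variable `y`. Multiplicativity is the Cartan formula. -/
noncomputable def totalPower :
    MvPolynomial σ (ZMod p) →ₐ[ZMod p] (MvPolynomial σ (ZMod p))[X] :=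
  MvPolynomial.aeval fun i => C (MvPolynomial.X i) + C (MvPolynomial.X i ^ p) * X

/-- The operation `P^k` (`Sq^k` if `p = 2`) on `𝔽_p[y_i : i ∈ σ]`. -/
noncomputable def steenrodPower (k : ℕ) : Module.End (ZMod p) (MvPolynomial σ (ZMod p)) where
  toFun f := (totalPower p σ f).coeff k
  map_add' f g := by simp
  map_smul' c f := by simp

/-- The Bockstein on `𝔽_p[y_i : i ∈ σ]`: it is `Sq^1` if `p = 2`, and it is zero if `p` is odd,
the `y_i` being of degree two and themselves Bocksteins. -/
noncomputable def bocksteinOp : Module.End (ZMod p) (MvPolynomial σ (ZMod p)) :=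
  if p = 2 then steenrodPower p σ 1 else 0

variable {p σ}

theorem coeff_eval₂_C_mul_X {A L : Type*} [CommRing A] [CommRing L] (ψ : A →+* L[X]) (v : L)
    (q : A[X]) (N : ℕ) :
    (eval₂ ψ (C v * X) q).coeff N =
      ∑ x ∈ Finset.HasAntidiagonal.antidiagonal N, (ψ (q.coeff x.2)).coeff x.1 * v ^ x.2 := by
  induction q using Polynomial.induction_on' with
  | add f g hf hg => simp [eval₂_add, hf, hg, add_mul, Finset.sum_add_distrib]
  | monomial m r =>
    rw [eval₂_monomial, mul_pow, ← C_pow, ← mul_assoc, coeff_mul_X_pow', coeff_mul_C]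
    split_ifs with h
    · rw [Finset.sum_eq_single (N - m, m)]
      · simp
      · rintro ⟨a, b⟩ hx hne
        have : m ≠ b := by
          rintro rfl
          apply hne
          simp only [Finset.HasAntidiagonal.mem_antidiagonal] at hx
          simp only [Prod.mk.injEq, and_true]
          omega
        simp [coeff_monomial, this]
      · intro hx
        exact absurd (by simp only [Finset.HasAntidiagonal.mem_antidiagonal]; omega) hx
    · symm
      apply Finset.sum_eq_zero
      rintro ⟨a, b⟩ hx
      have : m ≠ b := by
        rintro rfl
        simp only [Finset.HasAntidiagonal.mem_antidiagonal] at hx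
        omega
      simp [coeff_monomial, this]

/-- `T_x f = ∑ φ(P^k f) x^k`. -/
noncomputable def evalPower {S : Type*} [CommRing S] (φ : MvPolynomial σ (ZMod p) →+* S) (x : S) :
    MvPolynomial σ (ZMod p) →+* S :=
  (eval₂RingHom φ x).comp (totalPower p σ).toRingHom

theorem evalPower_X {S : Type*} [CommRing S] (φ : MvPolynomial σ (ZMod p) →+* S) (x : S) (i : σ) :
    evalPower φ x (MvPolynomial.X i) = φ (MvPolynomial.X i) + φ (MvPolynomial.X i) ^ p * x := by
  simp [evalPower, totalPower, eval₂_add, eval₂_mul, eval₂_pow]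

theorem evalPower_comm {S : Type*} [CommRing S] [CharP S p]
    (φ : MvPolynomial σ (ZMod p) →+* S) (x y x' y' : S) (h1 : x + y = x' + y')
    (h2 : x ^ p * y = x' ^ p * y') :
    evalPower (evalPower φ x) y = evalPower (evalPower φ x') y' := by
  apply MvPolynomial.ringHom_ext
  · intro r
    exact RingHom.congr_fun (RingHom.ext_zmod
      ((evalPower (evalPower φ x) y).comp MvPolynomial.C)
      ((evalPower (evalPower φ x') y').comp MvPolynomial.C)) r
  · intro i
    simp only [evalPower_X, add_pow_char, mul_pow]
    linear_combination (φ (MvPolynomial.X i)) ^ p * h1 +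
      ((φ (MvPolynomial.X i)) ^ p) ^ p * h2

theorem sum_steenrodPower {L : Type*} [CommRing L] [CharP L p]
    (φ : MvPolynomial σ (ZMod p) →+* L) (s u t : L) (h1 : s + 1 = u + t ^ p) (h2 : s = t * u)
    (f : MvPolynomial σ (ZMod p)) (N : ℕ) :
    ∑ x ∈ Finset.HasAntidiagonal.antidiagonal N,
        φ (steenrodPower p σ x.1 (steenrodPower p σ x.2 f)) * s ^ x.1 =
      ∑ x ∈ Finset.HasAntidiagonal.antidiagonal N,
        φ (steenrodPower p σ x.1 (steenrodPower p σ x.2 f)) * u ^ x.1 * (t ^ p) ^ x.2 := by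
  have key (x y : L) : (evalPower (evalPower ((C : L →+* L[X]).comp φ) (C x * X)) (C y * X) f).coeff
      N = ∑ z ∈ Finset.HasAntidiagonal.antidiagonal N,
        φ (steenrodPower p σ z.1 (steenrodPower p σ z.2 f)) * x ^ z.1 * y ^ z.2 := by
    have inner (g : MvPolynomial σ (ZMod p)) (a : ℕ) :
        (evalPower ((C : L →+* L[X]).comp φ) (C x * X) g).coeff a =
          φ (steenrodPower p σ a g) * x ^ a := by
      change (eval₂ ((C : L →+* L[X]).comp φ) (C x * X) (totalPower p σ g)).coeff a = _
      rw [coeff_eval₂_C_mul_X, Finset.sum_eq_single (0, a)]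
      · simp [steenrodPower]
      · rintro ⟨c, d⟩ hx hne
        have : c ≠ 0 := by
          rintro rfl
          apply hne
          simpa [Finset.HasAntidiagonal.mem_antidiagonal] using hx
        simp [coeff_C, this]
      · intro hx
        exact absurd (Finset.HasAntidiagonal.mem_antidiagonal.2 (zero_add a)) hx
    change (eval₂ (evalPower ((C : L →+* L[X]).comp φ) (C x * X)) (C y * X)
      (totalPower p σ f)).coeff N = _
    rw [coeff_eval₂_C_mul_X]
    exact Finset.sum_congr rfl fun z _ => by rw [inner]; rfl
  have e := evalPower_comm ((C : L →+* L[X]).comp φ) (C s * X) (C 1 * X) (C u * X) (C (t ^ p) * X)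
    (by rw [← add_mul, ← add_mul, ← C_add, ← C_add, h1])
    (by
      rw [mul_pow, mul_pow, h2]
      simp only [map_one, map_mul, C_pow, mul_pow]
      ring)
  have := congrArg (fun q => q.coeff N) (RingHom.congr_fun e f)
  simp only [key, one_pow, mul_one] at this
  exact this

theorem coeff_one_sub_pow {L : Type*} [CommRing L] (k m : ℕ) :
    PowerSeries.coeff m ((1 - PowerSeries.X : PowerSeries L) ^ k) = (-1) ^ m * (k.choose m : L) := by
  induction k generalizing m with
  | zero => cases m <;> simp [PowerSeries.coeff_one]
  | succ k ih =>
    rw [pow_succ, mul_sub, mul_one, map_sub, ih]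
    cases m with
    | zero => simp
    | succ m =>
      rw [PowerSeries.coeff_succ_mul_X, ih, Nat.choose_succ_succ]
      push_cast
      ring

theorem dvd_choose_mul (p r : ℕ) (hr : 0 < r) (hp : 0 < p) : p ∣ ((p - 1) * r + r).choose r := by
  obtain ⟨r, rfl⟩ : ∃ k, r = k + 1 := ⟨r - 1, by omega⟩
  obtain ⟨q, rfl⟩ : ∃ k, p = k + 1 := ⟨p - 1, by omega⟩
  have e : (q + 1 - 1) * (r + 1) + (r + 1) = (q * (r + 1) + r) + 1 := by simp; ring
  rw [e]
  have h := Nat.add_one_mul_choose_eq (q * (r + 1) + r) r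
  have h' : (r + 1) * ((q + 1) * (q * (r + 1) + r).choose r) =
      (r + 1) * (q * (r + 1) + r + 1).choose (r + 1) := by
    rw [mul_comm (r + 1) (Nat.choose _ _), ← h]; ring
  exact ⟨_, (Nat.eq_of_mul_eq_mul_left (Nat.succ_pos r) h').symm⟩

/-- The Adem relations hold on polynomial algebras. -/
theorem steenrodPower_adem (a b : ℕ) (hab : a < p * b) :
    steenrodPower p σ a * steenrodPower p σ b =
      ∑ j ∈ Finset.range (a + 1) with p * j ≤ a,
        ((-1 : ZMod p) ^ (a + j) * (((p - 1) * (b - j) - 1).choose (a - p * j) : ZMod p)) •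
          (steenrodPower p σ (a + b - j) * steenrodPower p σ j) := by
  have hp : p.Prime := Fact.out
  have hp2 := hp.two_le
  refine LinearMap.ext fun f => ?_
  have : CharP (MvPolynomial σ (ZMod p)) p := inferInstance
  have : CharP (PowerSeries (MvPolynomial σ (ZMod p))) p :=
    charP_of_injective_ringHom (f := (PowerSeries.C : (MvPolynomial σ (ZMod p)) →+* PowerSeries (MvPolynomial σ (ZMod p))))
      PowerSeries.C_injective p
  let t : PowerSeries (MvPolynomial σ (ZMod p)) := PowerSeries.X
  let q : PowerSeries (MvPolynomial σ (ZMod p)) := 1 - t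
  let v : PowerSeries (MvPolynomial σ (ZMod p)) := PowerSeries.mk 1
  have hvq : v * q = 1 := PowerSeries.mk_one_mul_one_sub_eq_one (MvPolynomial σ (ZMod p))
  have hqp : q ^ p = 1 - t ^ p := by simp [q, sub_pow_char]
  have hqp' : q ^ p = q ^ (p - 1) * q := by
    rw [← pow_succ, Nat.sub_add_cancel hp.one_le]
  have main := sum_steenrodPower (PowerSeries.C : (MvPolynomial σ (ZMod p)) →+* PowerSeries (MvPolynomial σ (ZMod p))) (t * q ^ (p - 1))
    (q ^ (p - 1)) t (by
      have : q ^ (p - 1) * q = 1 - t ^ p := by rw [← hqp', hqp]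
      have e : q = 1 - t := rfl
      rw [e] at this ⊢
      linear_combination -this) rfl f (a + b)
  have canc (m k : ℕ) (h : m ≤ k) : q ^ m * v ^ k = v ^ (k - m) := by
    obtain ⟨d, rfl⟩ := Nat.exists_eq_add_of_le h
    rw [pow_add, ← mul_assoc, ← mul_pow, mul_comm q v, hvq]
    simp
  have canc' (m k : ℕ) (h : k ≤ m) : q ^ m * v ^ k = q ^ (m - k) := by
    obtain ⟨d, rfl⟩ := Nat.exists_eq_add_of_le h
    rw [pow_add, mul_right_comm, ← mul_pow, mul_comm q v, hvq]
    simp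
  have main' := congrArg (fun z => PowerSeries.coeff a (z * v ^ ((p - 1) * a + 1))) main
  simp only [Finset.sum_mul, map_sum] at main'
  rw [Finset.sum_eq_single (a, b)] at main'
  rotate_left
  · rintro ⟨c, d⟩ hx hne
    simp only [Finset.HasAntidiagonal.mem_antidiagonal] at hx
    simp only
    rw [mul_assoc, PowerSeries.coeff_C_mul, mul_pow, mul_assoc, PowerSeries.coeff_X_pow_mul']
    split_ifs with hc
    · have hlt : c < a := by
        refine lt_of_le_of_ne hc ?_
        rintro rfl
        apply hne
        simp only [Prod.mk.injEq, true_and]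
        omega
      obtain ⟨r, rfl⟩ := Nat.exists_eq_add_of_le hc
      rw [← pow_mul, canc _ _ (by rw [mul_add]; omega)]
      have e : (p - 1) * (c + r) + 1 - (p - 1) * c = (p - 1) * r + 1 := by
        rw [mul_add]; omega
      rw [e]
      simp only [v]
      rw [PowerSeries.mk_one_pow_eq_mk_choose_add, PowerSeries.coeff_mk, Nat.add_sub_cancel_left,
        Nat.choose_symm_add, (CharP.cast_eq_zero_iff (MvPolynomial σ (ZMod p)) p _).2
          (dvd_choose_mul p r (by omega) hp.pos), mul_zero]
    · simp
  · intro hx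
    exact (hx (Finset.HasAntidiagonal.mem_antidiagonal.2 rfl)).elim
  have lhs : PowerSeries.coeff a (PowerSeries.C (steenrodPower p σ a (steenrodPower p σ b f)) *
      (t * q ^ (p - 1)) ^ a * v ^ ((p - 1) * a + 1)) =
      steenrodPower p σ a (steenrodPower p σ b f) := by
    rw [mul_assoc, PowerSeries.coeff_C_mul, mul_pow, mul_assoc, PowerSeries.coeff_X_pow_mul',
      if_pos le_rfl, ← pow_mul, canc _ _ (by omega)]
    simp [v]

  rw [lhs] at main'
  rw [Module.End.mul_apply, main', LinearMap.sum_apply]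
  rw [Finset.Nat.sum_antidiagonal_eq_sum_range_succ_mk, Finset.sum_filter,
    ← Finset.sum_range_reflect]
  have hrange : Finset.range (a + 1) ⊆ Finset.range (a + b).succ :=
    Finset.range_subset_range.2 (by omega)
  rw [← Finset.sum_subset hrange]
  · refine Finset.sum_congr rfl fun j hj => ?_
    rw [Finset.mem_range] at hj
    have e1 : (a + b).succ - 1 - j = a + b - j := by omega
    have e2 : a + b - (a + b - j) = j := by omega
    simp only [e1, e2]
    rw [mul_assoc, mul_assoc, PowerSeries.coeff_C_mul, mul_left_comm, ← pow_mul,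
      PowerSeries.coeff_X_pow_mul']
    split_ifs with hpj
    · have hjb : j < b := lt_of_mul_lt_mul_left (lt_of_le_of_lt hpj hab) (Nat.zero_le p)
      obtain ⟨d, rfl⟩ := Nat.exists_eq_add_of_lt hjb
      have hpd : 1 ≤ (p - 1) * (d + 1) := Nat.mul_pos (by omega) (by omega)
      have e3 : (p - 1) * (a + (j + d + 1) - j) = (p - 1) * a + (p - 1) * (d + 1) := by
        rw [← mul_add]; congr 1; omega
      have e4 : j + d + 1 - j = d + 1 := by omega
      rw [← pow_mul, e3, canc' _ _ (by omega), e4]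
      have e5 : (p - 1) * a + (p - 1) * (d + 1) - ((p - 1) * a + 1) = (p - 1) * (d + 1) - 1 := by
        omega
      rw [e5]
      simp only [q, t]
      rw [coeff_one_sub_pow]
      have sgn : ((-1 : ZMod p) ^ (a + j)) = (-1) ^ (a - p * j) := by
        rcases hp.eq_two_or_odd' with h2 | hodd
        · subst h2
          have : (-1 : ZMod 2) = 1 := CharTwo.neg_eq 1
          simp [this]
        · have e6 : a + j = (a - p * j) + (p * j + j) := by omega
          have : Even (p * j + j) := by
            have : p * j + j = (p + 1) * j := by ring
            rw [this]
            exact (hodd.add_one).mul_right j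
          rw [e6, pow_add, this.neg_one_pow, mul_one]
      rw [sgn, LinearMap.smul_apply, Module.End.mul_apply, Algebra.smul_def, mul_comm]
      simp
    · simp
  · intro j hj hj'
    simp only [Finset.mem_range] at hj hj'
    have e1 : (a + b).succ - 1 - j = a + b - j := by omega
    have e2 : a + b - (a + b - j) = j := by omega
    have hpj : ¬ p * j ≤ a := by
      have : 1 * j ≤ p * j := Nat.mul_le_mul_right j hp.one_le
      omega
    simp only [e1, e2]
    rw [mul_assoc, mul_assoc, PowerSeries.coeff_C_mul, mul_left_comm, ← pow_mul,
      PowerSeries.coeff_X_pow_mul', if_neg hpj, mul_zero]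

theorem steenrodPower_zero : steenrodPower p σ 0 = 1 := by
  have h : ((Polynomial.aeval (R := MvPolynomial σ (ZMod p)) 0).restrictScalars (ZMod p)).comp
      (totalPower p σ) = AlgHom.id (ZMod p) (MvPolynomial σ (ZMod p)) := by
    apply MvPolynomial.algHom_ext
    intro i
    simp [totalPower]
  refine LinearMap.ext fun f => ?_
  have := DFunLike.congr_fun h f
  simpa [steenrodPower, coeff_zero_eq_aeval_zero] using this

end Powers

/-! ### The action of the Steenrod algebra -/

section Action

variable (p : ℕ) [Fact p.Prime] (σ : Type*)

/-- The action of the generators on `𝔽_p[y_i : i ∈ σ]`. -/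
noncomputable def genOp : SteenrodGen → Module.End (ZMod p) (MvPolynomial σ (ZMod p))
  | SteenrodGen.bockstein => bocksteinOp p σ
  | SteenrodGen.power k => steenrodPower p σ k

/-- The action of the Steenrod algebra on `𝔽_p[y_i : i ∈ σ]`, as an algebra homomorphism. -/
noncomputable def steenrodAction :
    SteenrodAlgebra p →ₐ[ZMod p] Module.End (ZMod p) (MvPolynomial σ (ZMod p)) :=
  RingQuot.liftAlgHom (ZMod p) ⟨FreeAlgebra.lift (ZMod p) (genOp p σ), by
    intro x y h
    have hP (k : ℕ) : FreeAlgebra.lift (ZMod p) (genOp p σ) (freePower p k) =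
        steenrodPower p σ k := by simp [freePower, genOp]
    have hB : FreeAlgebra.lift (ZMod p) (genOp p σ) (freeBockstein p) = bocksteinOp p σ := by
      simp [freeBockstein, genOp]
    cases h with
    | power_zero => rw [hP, steenrodPower_zero, map_one]
    | adem a b hab =>
      simp only [map_mul, map_sum, map_smul, hP]
      exact steenrodPower_adem a b hab
    | bockstein_sq hp => simp [hB, bocksteinOp, hp]
    | adem_bockstein hp a b hab =>
      simp [hB, hP, bocksteinOp, hp]
    | bockstein_two hp => rw [hB, hP, bocksteinOp, if_pos hp]⟩

/-- `𝔽_p[y_i : i ∈ σ]` as a module over the Steenrod algebra. -/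
noncomputable instance : Module (SteenrodAlgebra p) (MvPolynomial σ (ZMod p)) :=
  Module.compHom _ (steenrodAction p σ).toRingHom

instance : IsScalarTower (ZMod p) (SteenrodAlgebra p) (MvPolynomial σ (ZMod p)) where
  smul_assoc c a f := by
    change steenrodAction p σ (c • a) f = c • steenrodAction p σ a f
    rw [map_smul, LinearMap.smul_apply]

variable {p σ}

/-- The class of `P^k` in the Steenrod algebra. -/
noncomputable def powerClass (p k : ℕ) : SteenrodAlgebra p :=
  RingQuot.mkAlgHom (ZMod p) (SteenrodRel p) (freePower p k)

theorem powerClass_smul (k : ℕ) (f : MvPolynomial σ (ZMod p)) :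
    powerClass p k • f = steenrodPower p σ k f := by
  change steenrodAction p σ (powerClass p k) f = _
  simp [steenrodAction, powerClass, freePower, genOp]

/-- A subspace stable under all `P^k` is stable under the Steenrod algebra. -/
theorem smul_mem_of_power_mem (N : Submodule (ZMod p) (MvPolynomial σ (ZMod p)))
    (h : ∀ k, ∀ f ∈ N, steenrodPower p σ k f ∈ N) (a : SteenrodAlgebra p)
    {f : MvPolynomial σ (ZMod p)} (hf : f ∈ N) : a • f ∈ N := by
  obtain ⟨x, rfl⟩ := RingQuot.mkAlgHom_surjective (ZMod p) (SteenrodRel p) a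
  change steenrodAction p σ (RingQuot.mkAlgHom (ZMod p) (SteenrodRel p) x) f ∈ N
  simp only [steenrodAction, RingQuot.liftAlgHom_mkAlgHom_apply]
  induction x using FreeAlgebra.induction generalizing f with
  | grade0 r =>
    rw [AlgHom.commutes, Module.algebraMap_end_apply]
    exact N.smul_mem r hf
  | grade1 g =>
    rw [FreeAlgebra.lift_ι_apply]
    cases g with
    | bockstein =>
      simp only [genOp, bocksteinOp]
      split_ifs
      · exact h 1 f hf
      · exact N.zero_mem
    | power k => exact h k f hf
  | mul x y hx hy =>
    rw [map_mul, Module.End.mul_apply]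
    exact hx (hy hf)
  | add x y hx hy =>
    rw [map_add, LinearMap.add_apply]
    exact N.add_mem (hx hf) (hy hf)

end Action

/-! ### Atomic graded modules -/

section Atomic

variable {k A M : Type*} [CommRing k] [Ring A] [AddCommGroup M] [Module k M] [Module A M]

/-- `f` is a module map of degree zero for the grading `𝓜` of `M`. -/
def IsDegreeZero (𝓜 : ℕ → Submodule k M) (f : M →ₗ[A] M) : Prop :=
  ∀ i, ∀ x ∈ 𝓜 i, f x ∈ 𝓜 i

variable (A) in
/-- The graded `A`-module `M`, with homogeneous components `𝓜 i`, is atomic: every `A`-linear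
self-map of degree zero which is an isomorphism on the lowest positive degree in which `M` does not
vanish is an isomorphism. -/
def IsAtomic (𝓜 : ℕ → Submodule k M) : Prop :=
  ∀ f : M →ₗ[A] M, IsDegreeZero 𝓜 f →
    ∀ r, IsLeast {i | 0 < i ∧ 𝓜 i ≠ ⊥} r → Set.BijOn f (𝓜 r) (𝓜 r) → Function.Bijective f

end Atomic

/-! ### The classical Dickson algebra -/

section Classical

variable (p : ℕ) [Fact p.Prime] (n : ℕ)

/-- The cohomological degree of the polynomial generators `y_i`. -/
def genDegree (p : ℕ) : ℕ := if p = 2 then 1 else 2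

/-- The action of a matrix `g` on `𝔽_p[y_1, …, y_n]` by linear substitution. -/
noncomputable def subst (g : Matrix (Fin n) (Fin n) (ZMod p)) :
    MvPolynomial (Fin n) (ZMod p) →ₐ[ZMod p] MvPolynomial (Fin n) (ZMod p) :=
  MvPolynomial.aeval fun j => ∑ i, g i j • MvPolynomial.X i

/-- The algebra of invariants `𝔽_p[y_1, …, y_n]^{GL_n}`. -/
noncomputable def invariants : Subalgebra (ZMod p) (MvPolynomial (Fin n) (ZMod p)) :=
  ⨅ g : GL (Fin n) (ZMod p), AlgHom.equalizer (subst p n g) (AlgHom.id (ZMod p) _)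

variable {p n} in
theorem mem_invariants {f : MvPolynomial (Fin n) (ZMod p)} :
    f ∈ invariants p n ↔ ∀ g : GL (Fin n) (ZMod p), subst p n g f = f := by
  simp [invariants, Algebra.mem_iInf, AlgHom.mem_equalizer]

variable {p n} in
theorem steenrodPower_subst (g : Matrix (Fin n) (Fin n) (ZMod p)) (k : ℕ)
    (f : MvPolynomial (Fin n) (ZMod p)) :
    steenrodPower p (Fin n) k (subst p n g f) = subst p n g (steenrodPower p (Fin n) k f) := by
  have h : (totalPower p (Fin n)).comp (subst p n g) =
      (Polynomial.mapAlgHom (subst p n g)).comp (totalPower p (Fin n)) := by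
    apply MvPolynomial.algHom_ext
    intro j
    simp [totalPower, subst, sum_pow_char, _root_.smul_pow, ZMod.pow_card, Finset.sum_add_distrib,
      Finset.sum_mul, map_sum, smul_add, ← Polynomial.smul_C]
  have := congrArg (fun q => q.coeff k) (DFunLike.congr_fun h f)
  simpa [steenrodPower] using this

/-- The classical Dickson algebra `D_n = 𝔽_p[y_1, …, y_n]^{GL_n}` as a module over the Steenrod
algebra. -/
noncomputable def dickson : Submodule (SteenrodAlgebra p) (MvPolynomial (Fin n) (ZMod p)) where
  carrier := invariants p n
  add_mem' := (invariants p n).add_mem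
  zero_mem' := (invariants p n).zero_mem
  smul_mem' a _ hf := smul_mem_of_power_mem (Subalgebra.toSubmodule (invariants p n))
    (fun k f hf => mem_invariants.2 fun g => by
      rw [← steenrodPower_subst, mem_invariants.1 hf g]) a hf

variable {p n} in
theorem constantCoeff_steenrodPower (k : ℕ) (f : MvPolynomial (Fin n) (ZMod p))
    (hf : MvPolynomial.constantCoeff f = 0) :
    MvPolynomial.constantCoeff (steenrodPower p (Fin n) k f) = 0 := by
  have hp : p ≠ 0 := (Fact.out : p.Prime).ne_zero
  have h : (Polynomial.mapRingHom MvPolynomial.constantCoeff).comp (totalPower p (Fin n)).toRingHom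
      = C.comp (MvPolynomial.constantCoeff (R := ZMod p) (σ := Fin n)) := by
    apply MvPolynomial.ringHom_ext
    · intro r
      exact RingHom.congr_fun (RingHom.ext_zmod
        (((Polynomial.mapRingHom MvPolynomial.constantCoeff).comp
          (totalPower p (Fin n)).toRingHom).comp MvPolynomial.C)
        ((C.comp (MvPolynomial.constantCoeff (R := ZMod p) (σ := Fin n))).comp MvPolynomial.C)) r
    · intro i
      simp [totalPower, hp]
  have := congrArg (fun q => q.coeff k) (DFunLike.congr_fun h f)
  simpa [steenrodPower, hf] using this

/-- The augmentation ideal of the classical Dickson algebra, that is the invariants without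
constant term, as a module over the Steenrod algebra. -/
noncomputable def augmentation :
    Submodule (SteenrodAlgebra p) (MvPolynomial (Fin n) (ZMod p)) where
  carrier := {f | f ∈ dickson p n ∧ MvPolynomial.constantCoeff f = 0}
  add_mem' hf hg := ⟨add_mem hf.1 hg.1, by rw [map_add, hf.2, hg.2, add_zero]⟩
  zero_mem' := ⟨zero_mem _, map_zero _⟩
  smul_mem' a f hf := by
    refine ⟨(dickson p n).smul_mem a hf.1, ?_⟩
    let N : Submodule (ZMod p) (MvPolynomial (Fin n) (ZMod p)) :=
      { carrier := {f | MvPolynomial.constantCoeff f = 0}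
        add_mem' := fun {f g} (hf : _ = _) (hg : _ = _) => by
          change MvPolynomial.constantCoeff (f + g) = 0
          rw [map_add, hf, hg, add_zero]
        zero_mem' := map_zero _
        smul_mem' := fun c f (hf : _ = _) => by
          change MvPolynomial.constantCoeff (c • f) = 0
          rw [MvPolynomial.smul_eq_C_mul, map_mul, hf, mul_zero] }
    exact smul_mem_of_power_mem N (fun k f hf => constantCoeff_steenrodPower k f hf) a hf.2

/-- The elements of cohomological degree `i` of a submodule of `𝔽_p[y_1, …, y_n]`. -/
noncomputable def component (N : Submodule (SteenrodAlgebra p) (MvPolynomial (Fin n) (ZMod p)))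
    (i : ℕ) : Submodule (ZMod p) N :=
  (MvPolynomial.weightedHomogeneousSubmodule (ZMod p) (fun _ : Fin n => genDegree p) i).comap
    (N.subtype.restrictScalars (ZMod p))

/-- The polynomial `∏ (X - v)` over all linear forms `v` in `y_1, …, y_n`. -/
noncomputable def orbitPolynomial : (MvPolynomial (Fin n) (ZMod p))[X] :=
  ∏ v : Fin n → ZMod p, (X - C (∑ i, v i • MvPolynomial.X i))

/-- The Dickson invariant `d_{n,i}`, of degree `2(p^n - p^{n-i})` (`2^n - 2^{n-i}` if `p = 2`):
`∏ (X - v) = ∑ (-1)^i d_{n,i} X^{p^{n-i}}`. -/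
noncomputable def dicksonInvariant (i : ℕ) : MvPolynomial (Fin n) (ZMod p) :=
  (-1) ^ i * (orbitPolynomial p n).coeff (p ^ (n - i))

variable {p n} in
theorem dicksonInvariant_mem (i : ℕ) : dicksonInvariant p n i ∈ dickson p n := by
  refine mem_invariants.2 fun g => ?_
  have hlin (v : Fin n → ZMod p) : subst p n g (∑ j, v j • MvPolynomial.X j) =
      ∑ i, ((g : Matrix (Fin n) (Fin n) (ZMod p)).mulVec v) i • MvPolynomial.X i := by
    simp only [subst, map_sum, map_smul, MvPolynomial.aeval_X, Finset.smul_sum, smul_smul,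
      Matrix.mulVec, dotProduct, Finset.sum_smul]
    rw [Finset.sum_comm]
    exact Finset.sum_congr rfl fun _ _ => Finset.sum_congr rfl fun _ _ => by rw [mul_comm]
  have hbij : Function.Bijective (g : Matrix (Fin n) (Fin n) (ZMod p)).mulVec :=
    Function.bijective_iff_has_inverse.2
      ⟨((g⁻¹ : GL (Fin n) (ZMod p)) : Matrix (Fin n) (Fin n) (ZMod p)).mulVec,
        fun v => by rw [Matrix.mulVec_mulVec, ← Units.val_mul]; simp,
        fun v => by rw [Matrix.mulVec_mulVec, ← Units.val_mul]; simp⟩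
  have h : (orbitPolynomial p n).map (subst p n g : _ →+* _) = orbitPolynomial p n := by
    rw [orbitPolynomial, Polynomial.map_prod]
    refine Fintype.prod_bijective _ hbij _ _ fun v => ?_
    rw [Polynomial.map_sub, Polynomial.map_X, Polynomial.map_C, ← hlin v]
    rfl
  have hc := congrArg (fun q => q.coeff (p ^ (n - i))) h
  simp only [Polynomial.coeff_map] at hc
  rw [dicksonInvariant, map_mul, map_pow, map_neg, map_one]
  exact congrArg _ hc

theorem one_mem_dickson : (1 : MvPolynomial (Fin n) (ZMod p)) ∈ dickson p n :=
  (invariants p n).one_mem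

end Classical

end Dickson

/-!
For a submodule `N` over the Steenrod algebra and a homogeneous `x ∈ N`, the coefficients of
`x(∑ λ_J y^(p^J))` in the indeterminates `λ_J` lie in `N`: over an algebraically closed field an
additive polynomial factors into maps `y ↦ y + a y^p`, and each of these acts as the total Steenrod
power.

Let `x ≠ 0` be a homogeneous invariant without constant term, and let `d` be minimal such that
`x(tM) ≠ 0` for some `d × n` matrix `M` over `𝔽_p`. Then `x(tM)` vanishes unless the rows of `M` are
independent, and is otherwise a polynomial `r(t)` which does not depend on `M`. Summing over
hyperplanes turns this into the indicator function of the invertible `n × n` matrices, which is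
`det ^ (p - 1)`. Substituting truncated traces for the entries of the matrix and extracting a top
coefficient shows that the `(p-1)`st powers of the determinants `det (y_i ^ (p ^ N_l))`, for all
large `N_l`, are multiples of `x` over the Steenrod algebra. Hence any two nonzero homogeneous
elements of `D̄_n` have a common nonzero multiple. If an endomorphism `f` of degree zero is not
nilpotent on the homogeneous element `w`, then some `f^k w ≠ 0` is a periodic point of `f`, because
each degree is finite; a common multiple of `f^k w` with a homogeneous `x` shows that `f x ≠ 0`.
So `f` is injective, hence bijective, in each degree.

Such a `w` is provided by `d_{n,1}`, which spans its degree: an invariant of at most this degree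
vanishing on `𝔽_p^n` restricts to the hyperplane `y_0 = 0` as a `p`-th power of an invariant in
fewer variables, which is zero by induction; then every linear form `y_0 + ℓ` divides it with
multiplicity at least `p - 1`, which are too many factors.
-/

namespace Dickson

section ScalarExtension

variable {k σ R S : Type*} [Field k] [CommRing R] [Algebra k R] [CommRing S] [Algebra k S]
  {N : Submodule k (MvPolynomial σ k)}

/-- The extension of scalars `R ⊗ N`, for `N` a subspace of `k[y_i : i ∈ σ]`, inside
`R[y_i : i ∈ σ]`. Membership is tested by applying linear functionals `R → k` to all coefficients,
which makes no reference to generators. -/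
def scalarExtension (N : Submodule k (MvPolynomial σ k)) (R : Type*) [CommRing R] [Algebra k R] :
    Submodule R (MvPolynomial σ R) where
  carrier := {z | ∀ φ : R →ₗ[k] k, ∃ f ∈ N, ∀ m, f.coeff m = φ (z.coeff m)}
  add_mem' {z w} hz hw φ := by
    obtain ⟨f, hf, hfz⟩ := hz φ
    obtain ⟨g, hg, hgw⟩ := hw φ
    exact ⟨f + g, N.add_mem hf hg, fun m => by simp [hfz, hgw]⟩
  zero_mem' φ := ⟨0, N.zero_mem, by simp⟩
  smul_mem' r z hz φ := by simpa using hz (φ ∘ₗ LinearMap.mulLeft k r)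

theorem mem_scalarExtension_of_coeff_eq {z : MvPolynomial σ R} (hz : z ∈ scalarExtension N R)
    {w : MvPolynomial σ S} (φ : R →ₗ[k] S) (hφ : ∀ m, w.coeff m = φ (z.coeff m)) :
    w ∈ scalarExtension N S := fun ψ => by
  simpa [hφ] using hz (ψ ∘ₗ φ)

theorem map_mem_scalarExtension {z : MvPolynomial σ R} (φ : R →ₐ[k] S)
    (hz : z ∈ scalarExtension N R) : z.map (φ : R →+* S) ∈ scalarExtension N S :=
  mem_scalarExtension_of_coeff_eq hz φ.toLinearMap fun m => by simp [MvPolynomial.coeff_map]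

theorem mem_scalarExtension_of_map_mem {z : MvPolynomial σ R} {φ : R →ₐ[k] S}
    (hφ : Function.Injective φ) (hz : z.map (φ : R →+* S) ∈ scalarExtension N S) :
    z ∈ scalarExtension N R := by
  obtain ⟨ψ, hψ⟩ := φ.toLinearMap.exists_leftInverse_of_injective (LinearMap.ker_eq_bot.2 hφ)
  exact mem_scalarExtension_of_coeff_eq hz ψ fun m => by
    simpa [MvPolynomial.coeff_map] using (LinearMap.congr_fun hψ (z.coeff m)).symm

theorem map_algebraMap_mem_scalarExtension {f : MvPolynomial σ k} (hf : f ∈ N) :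
    f.map (algebraMap k R) ∈ scalarExtension N R := fun φ =>
  ⟨φ 1 • f, N.smul_mem _ hf, fun m => by
    simp [MvPolynomial.coeff_map, Algebra.algebraMap_eq_smul_one, mul_comm]⟩

theorem span_map_algebraMap_le_scalarExtension :
    Submodule.span R (MvPolynomial.map (algebraMap k R) '' (N : Set (MvPolynomial σ k))) ≤
      scalarExtension N R :=
  Submodule.span_le.2 <| Set.image_subset_iff.2 fun _ => map_algebraMap_mem_scalarExtension

theorem mem_of_smul_map_algebraMap_mem_scalarExtension {f : MvPolynomial σ k} {r : R} (hr : r ≠ 0)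
    (hf : r • f.map (algebraMap k R) ∈ scalarExtension N R) : f ∈ N := by
  obtain ⟨φ, hφ⟩ : ∃ φ : R →ₗ[k] k, φ r ≠ 0 := by
    by_contra! h
    exact hr ((Module.forall_dual_apply_eq_zero_iff k r).1 h)
  obtain ⟨g, hg, hgf⟩ := hf φ
  have hgf : g = φ r • f := by
    ext m
    rw [hgf, MvPolynomial.coeff_smul, MvPolynomial.coeff_map, smul_eq_mul, mul_comm,
      ← Algebra.smul_def, map_smul, MvPolynomial.coeff_smul, smul_eq_mul, smul_eq_mul, mul_comm]
  exact (N.smul_mem_iff hφ).1 (hgf ▸ hg)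

theorem coeff_coeff_commAlgEquiv {ι A : Type*} [CommSemiring A]
    (z : MvPolynomial σ (MvPolynomial ι A)) (b : ι →₀ ℕ) (m : σ →₀ ℕ) :
    ((MvPolynomial.commAlgEquiv A σ ι z).coeff b).coeff m = (z.coeff m).coeff b := by
  classical
  induction z using MvPolynomial.induction_on' with
  | add z w hz hw => simp [hz, hw]
  | monomial m' a =>
    induction a using MvPolynomial.induction_on' with
    | add a c ha hc => simp only [map_add, MvPolynomial.coeff_add, ha, hc]
    | monomial b' a =>
      have h : MvPolynomial.commAlgEquiv A σ ι (.monomial m' (.monomial b' a)) =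
          .monomial b' (.monomial m' a) := AddMonoidAlgebra.commAlgEquiv_single_single ..
      simp only [h, MvPolynomial.coeff_monomial]
      split_ifs <;> simp_all

theorem coeff_commAlgEquiv_mem_scalarExtension {ι : Type*} {z : MvPolynomial σ (MvPolynomial ι R)}
    (hz : z ∈ scalarExtension N (MvPolynomial ι R)) (b : ι →₀ ℕ) :
    (MvPolynomial.commAlgEquiv R σ ι z).coeff b ∈ scalarExtension N R :=
  mem_scalarExtension_of_coeff_eq hz ((MvPolynomial.lcoeff R b).restrictScalars k)
    fun m => coeff_coeff_commAlgEquiv z b m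

end ScalarExtension

section AdditivePolynomial

variable {σ R S : Type*} [CommRing R] [CommRing S]

/-- The additive polynomial `∑_{J < M} λ_J y_i^(p^J)`, to be substituted for `y_i`. -/
noncomputable def additivePolynomial (p M : ℕ) (coef : ℕ → R) (i : σ) : MvPolynomial σ R :=
  ∑ J ∈ Finset.range M, MvPolynomial.C (coef J) * MvPolynomial.X i ^ p ^ J

theorem map_additivePolynomial (φ : R →+* S) (p M : ℕ) (coef : ℕ → R) (i : σ) :
    (additivePolynomial p M coef i).map φ = additivePolynomial p M (fun J => φ (coef J)) i := by
  simp [additivePolynomial]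

theorem aeval_additivePolynomial_algHom {k : Type*} [CommRing k] [Algebra k R] [Algebra k S]
    (φ : R →ₐ[k] S) (p M : ℕ) (coef : ℕ → R) (x : MvPolynomial σ k) :
    MvPolynomial.aeval (additivePolynomial p M fun J => φ (coef J)) x =
      (MvPolynomial.aeval (additivePolynomial p M coef) x).map (φ : R →+* S) := by
  change _ = MvPolynomial.mapAlgHom φ _
  rw [← AlgHom.comp_apply, MvPolynomial.comp_aeval]
  exact congrArg (fun v => MvPolynomial.aeval v x)
    (funext fun i => (map_additivePolynomial (φ : R →+* S) p M coef i).symm)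

theorem aeval_X_add_C_mul_X_pow_additivePolynomial (p : ℕ) [ExpChar R p] {M : ℕ}
    {coef coef' : ℕ → R} {a : R} (h_zero : coef 0 = coef' 0)
    (h_succ : ∀ J, coef (J + 1) = coef' (J + 1) + coef' J * a ^ p ^ J)
    (h_last : coef' (M + 1) = 0) (i : σ) :
    MvPolynomial.aeval (fun i => MvPolynomial.X i + MvPolynomial.C a * MvPolynomial.X i ^ p)
        (additivePolynomial p (M + 1) coef' i) = additivePolynomial p (M + 2) coef i := by
  have pad : ∑ J ∈ Finset.range (M + 1), MvPolynomial.C (coef' J) * MvPolynomial.X i ^ p ^ J =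
      ∑ J ∈ Finset.range (M + 2), MvPolynomial.C (coef' J) * MvPolynomial.X i ^ p ^ J := by
    rw [Finset.sum_range_succ _ (M + 1), h_last, map_zero, zero_mul, add_zero]
  simp only [additivePolynomial, map_sum, map_mul, map_pow, MvPolynomial.aeval_X,
    MvPolynomial.algHom_C, MvPolynomial.algebraMap_eq, add_pow_expChar_pow, mul_add,
    Finset.sum_add_distrib]
  rw [pad, Finset.sum_range_succ', Finset.sum_range_succ' _ (M + 1), h_zero, add_right_comm,
    ← Finset.sum_add_distrib]
  congr 1
  refine Finset.sum_congr rfl fun J _ => ?_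
  rw [h_succ, map_add, map_mul, mul_pow, ← pow_mul, ← pow_succ', map_pow]
  ring

theorem exists_additive_factorization {K : Type*} [Field K] [IsAlgClosed K] {p : ℕ} (hp : 0 < p)
    (M : ℕ) {coef : ℕ → K} (h : coef 0 ≠ 0) :
    ∃ (coef' : ℕ → K) (a : K), coef 0 = coef' 0 ∧
      (∀ J, coef (J + 1) = coef' (J + 1) + coef' J * a ^ p ^ J) ∧ coef' (M + 1) = 0 := by
  let q : ℕ → K[X] := fun J => Nat.rec (C (coef 0)) (fun J r => C (coef (J + 1)) - r * X ^ p ^ J) J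
  have q_succ (J : ℕ) : q (J + 1) = C (coef (J + 1)) - q J * X ^ p ^ J := rfl
  have natDegree_q_succ (J : ℕ) (hJ : q J ≠ 0) : 0 < (q (J + 1)).natDegree := by
    have hdeg : (q J * X ^ p ^ J).natDegree = (q J).natDegree + p ^ J := natDegree_mul_X_pow _ hJ
    have := pow_pos hp J
    rw [q_succ, natDegree_sub_eq_right_of_natDegree_lt (by rw [natDegree_C]; omega)]
    omega
  have q_ne_zero (J : ℕ) : q J ≠ 0 := by
    induction J with
    | zero => exact C_ne_zero.2 h
    | succ J ih => exact ne_zero_of_natDegree_gt (natDegree_q_succ J ih)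
  obtain ⟨a, ha⟩ := IsAlgClosed.exists_root (q (M + 1))
    (natDegree_pos_iff_degree_pos.1 (natDegree_q_succ M (q_ne_zero M))).ne'
  exact ⟨fun J => (q J).eval a, a, (eval_C ..).symm, fun J => by simp [q_succ], ha⟩

theorem aeval_mul_left_of_isHomogeneous [Algebra R S] {f : MvPolynomial σ R} {m : ℕ}
    (hf : f.IsHomogeneous m) (c : S) (v : σ → S) :
    MvPolynomial.aeval (fun i => c * v i) f = c ^ m * MvPolynomial.aeval v f := by
  simp only [MvPolynomial.aeval_def, MvPolynomial.eval₂_eq, Finset.mul_sum]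
  refine Finset.sum_congr rfl fun d hd => ?_
  have degree_eq : ∑ i ∈ d.support, d i = m :=
    (hf.degree_eq_sum_deg_support hd).symm
  rw [← degree_eq, ← Finset.prod_pow_eq_pow_sum, mul_left_comm, ← Finset.prod_mul_distrib]
  simp only [mul_pow]

end AdditivePolynomial

section Milnor

variable {p : ℕ} [Fact p.Prime] {σ : Type*}
  {N : Submodule (SteenrodAlgebra p) (MvPolynomial σ (ZMod p))} {x : MvPolynomial σ (ZMod p)}

theorem steenrodPower_mem (k : ℕ) (hx : x ∈ N) : steenrodPower p σ k x ∈ N := by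
  rw [← powerClass_smul]
  exact N.smul_mem _ hx

section Field

variable {K : Type*} [Field K] [Algebra (ZMod p) K]

theorem aeval_X_add_C_mul_X_pow (a : K) (x : MvPolynomial σ (ZMod p)) :
    MvPolynomial.aeval (fun i => MvPolynomial.X i + MvPolynomial.C a * MvPolynomial.X i ^ p) x =
      ∑ k ∈ Finset.range ((totalPower p σ x).natDegree + 1),
        a ^ k • (steenrodPower p σ k x).map (algebraMap (ZMod p) K) := by
  let ev : (MvPolynomial σ (ZMod p))[X] →ₐ[ZMod p] MvPolynomial σ K :=
    Polynomial.eval₂AlgHom (MvPolynomial.mapAlgHom (Algebra.ofId _ _)) (MvPolynomial.C a)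
      fun _ => mul_comm _ _
  have factor : MvPolynomial.aeval (fun i => MvPolynomial.X i + MvPolynomial.C a *
      MvPolynomial.X i ^ p) = ev.comp (totalPower p σ) := by
    ext1 i
    change _ = eval₂ _ _ (totalPower p σ _)
    simp [totalPower, eval₂_pow, mul_comm]
  rw [factor, AlgHom.comp_apply]
  change eval₂ _ _ (totalPower p σ x) = _
  rw [eval₂_eq_sum_range]
  refine Finset.sum_congr rfl fun k _ => ?_
  rw [MvPolynomial.smul_eq_C_mul, MvPolynomial.C_pow, mul_comm]
  rfl

theorem aeval_X_add_C_mul_X_pow_mem_span (a : K) {z : MvPolynomial σ K}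
    (hz : z ∈ Submodule.span K (MvPolynomial.map (algebraMap (ZMod p) K) '' (N : Set _))) :
    MvPolynomial.aeval (fun i => MvPolynomial.X i + MvPolynomial.C a * MvPolynomial.X i ^ p) z ∈
      Submodule.span K (MvPolynomial.map (algebraMap (ZMod p) K) '' (N : Set _)) := by
  refine (Submodule.span_le (p := Submodule.comap (MvPolynomial.aeval fun i => MvPolynomial.X i +
    MvPolynomial.C a * MvPolynomial.X i ^ p).toLinearMap (Submodule.span K _))).2 ?_ hz
  rintro _ ⟨x, hx, rfl⟩
  rw [SetLike.mem_coe, Submodule.mem_comap, AlgHom.toLinearMap_apply,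
    MvPolynomial.aeval_map_algebraMap, aeval_X_add_C_mul_X_pow]
  exact Submodule.sum_mem _ fun k _ => Submodule.smul_mem _ _
    (Submodule.subset_span ⟨_, steenrodPower_mem k hx, rfl⟩)

/- Additive polynomials factor over an algebraically closed field, and each factor
`y ↦ y + a y^p` acts as the total operation `∑ a^k P^k`. -/
theorem aeval_additivePolynomial_mem_span [IsAlgClosed K] {m : ℕ} (hx : x ∈ N)
    (hm : x.IsHomogeneous m) (M : ℕ) {coef : ℕ → K} (h : coef 0 ≠ 0) :
    MvPolynomial.aeval (additivePolynomial p (M + 1) coef) x ∈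
      Submodule.span K (MvPolynomial.map (algebraMap (ZMod p) K) '' (N : Set _)) := by
  induction M generalizing coef with
  | zero =>
    have scale : additivePolynomial p (0 + 1) coef =
        fun i : σ => MvPolynomial.C (coef 0) * MvPolynomial.X i := by
      funext i
      simp [additivePolynomial]
    rw [scale, aeval_mul_left_of_isHomogeneous hm, ← MvPolynomial.C_pow,
      ← MvPolynomial.smul_eq_C_mul, ← MvPolynomial.aeval_map_algebraMap K,
      MvPolynomial.aeval_X_left_apply]
    exact Submodule.smul_mem _ _ (Submodule.subset_span ⟨x, hx, rfl⟩)
  | succ M ih =>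
    obtain ⟨coef', a, h_zero, h_succ, h_last⟩ := exists_additive_factorization
      (Fact.out : p.Prime).pos M h
    have : ExpChar K p := expChar_of_injective_algebraMap (algebraMap (ZMod p) K).injective p
    have composed := aeval_X_add_C_mul_X_pow_mem_span (N := N) a (ih (h_zero ▸ h))
    rw [← AlgHom.restrictScalars_apply (ZMod p), ← AlgHom.comp_apply,
      MvPolynomial.comp_aeval] at composed
    simpa only [AlgHom.restrictScalars_apply,
      aeval_X_add_C_mul_X_pow_additivePolynomial p h_zero h_succ h_last] using composed

end Field

theorem aeval_additivePolynomial_mem_scalarExtension {R : Type*} [CommRing R] [Algebra (ZMod p) R]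
    {m : ℕ} (hx : x ∈ N) (hm : x.IsHomogeneous m) (M : ℕ) (coef : ℕ → R) :
    MvPolynomial.aeval (additivePolynomial p (M + 1) coef) x ∈
      scalarExtension (N.restrictScalars (ZMod p)) R := by
  let A := MvPolynomial ℕ (ZMod p)
  let ι : A →ₐ[ZMod p] AlgebraicClosure (FractionRing A) := IsScalarTower.toAlgHom (ZMod p) A _
  have hι : Function.Injective ι := by
    change Function.Injective (algebraMap A _)
    rw [IsScalarTower.algebraMap_eq A (FractionRing A)]
    exact (algebraMap (FractionRing A) _).injective.comp (IsFractionRing.injective A _)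
  have generic : MvPolynomial.aeval (additivePolynomial p (M + 1) MvPolynomial.X) x ∈
      scalarExtension (N.restrictScalars (ZMod p)) A := by
    refine mem_scalarExtension_of_map_mem hι ?_
    rw [← aeval_additivePolynomial_algHom]
    exact span_map_algebraMap_le_scalarExtension <| aeval_additivePolynomial_mem_span hx hm M
      ((map_ne_zero_iff ι hι).2 (MvPolynomial.X_ne_zero 0))
  have specialized := map_mem_scalarExtension (MvPolynomial.aeval coef : A →ₐ[ZMod p] R) generic
  rw [← aeval_additivePolynomial_algHom] at specialized
  simpa only [MvPolynomial.aeval_X] using specialized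

end Milnor

section DigitSum

variable {p : ℕ}

theorem digits_sum_add_le [Fact p.Prime] (a b : ℕ) :
    (p.digits (a + b)).sum ≤ (p.digits a).sum + (p.digits b).sum := by
  have padic_le : padicValNat p a.factorial + padicValNat p b.factorial ≤
      padicValNat p (a + b).factorial := by
    rw [← padicValNat.mul a.factorial_ne_zero b.factorial_ne_zero]
    exact (padicValNat_dvd_iff_le (a + b).factorial_ne_zero).1
      (pow_padicValNat_dvd.trans (Nat.factorial_mul_factorial_dvd_factorial_add a b))
  have legendre := Nat.mul_le_mul_left (p - 1) padic_le
  simp only [mul_add, sub_one_mul_padicValNat_factorial] at legendre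
  have := Nat.digit_sum_le p a
  have := Nat.digit_sum_le p b
  have := Nat.digit_sum_le p (a + b)
  omega

theorem digits_sum_pow (hp : 1 < p) (J : ℕ) : (p.digits (p ^ J)).sum = 1 := by
  rw [← mul_one (p ^ J), Nat.digits_base_pow_mul hp one_pos]
  simp [Nat.digits_of_lt p 1 one_ne_zero hp]

theorem le_digits_sum_mul_pow_sub_one (hp : 1 < p) {a : ℕ} (ha : 0 < a) (e : ℕ) :
    e ≤ (p.digits (a * p ^ e - 1)).sum := by
  induction e with
  | zero => exact Nat.zero_le _
  | succ e ih =>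
    have hpos : 0 < a * p ^ e := Nat.mul_pos ha (pow_pos (by omega) e)
    have split_last_digit : a * p ^ (e + 1) - 1 = (p - 1) + p * (a * p ^ e - 1) := by
      rw [pow_succ, ← mul_assoc, Nat.mul_sub, mul_one, mul_comm p]
      have : 1 * p ≤ a * p ^ e * p := Nat.mul_le_mul_right p hpos
      omega
    rw [split_last_digit, Nat.digits_add p hp _ _ (by omega) (Or.inl (by omega)), List.sum_cons]
    omega

variable {ι S : Type*} [CommRing S]

/-- The largest base `p` digit sum of an exponent of the variable `l` in `z`. Unlike the degree, it
does not grow under `p`-th powers, and so bounds polynomials in `traceSum p N l v` for all `N`. -/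
noncomputable def digitDegree (p : ℕ) (l : ι) (z : MvPolynomial ι S) : ℕ :=
  AddMonoidAlgebra.supDegree (fun k : ι →₀ ℕ => (p.digits (k l)).sum) z

theorem digits_sum_le_digitDegree {l : ι} {z : MvPolynomial ι S} {k : ι →₀ ℕ}
    (hk : z.coeff k ≠ 0) : (p.digits (k l)).sum ≤ digitDegree p l z :=
  Finset.le_sup (f := fun k : ι →₀ ℕ => (p.digits (k l)).sum) (MvPolynomial.mem_support_iff.2 hk)

theorem digitDegree_aeval_le [Fact p.Prime] {κ A : Type*} [CommRing A] [Algebra A S] {l : ι}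
    {Y : κ → MvPolynomial ι S} (hY : ∀ i, digitDegree p l (Y i) ≤ 1) (h : MvPolynomial κ A) :
    digitDegree p l (MvPolynomial.aeval Y h) ≤ h.totalDegree := by
  have subadditive (a b : ι →₀ ℕ) : (p.digits ((a + b) l)).sum ≤
      (p.digits (a l)).sum + (p.digits (b l)).sum := digits_sum_add_le _ _
  have zero_le : (p.digits ((0 : ι →₀ ℕ) l)).sum ≤ 0 := by simp
  have digitDegree_prod_le (d : κ →₀ ℕ) :
      digitDegree p l (∏ i ∈ d.support, Y i ^ d i) ≤ ∑ i ∈ d.support, d i :=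
    (AddMonoidAlgebra.sup_support_coeff_finsetProd_le zero_le subadditive _ _).trans <|
      Finset.sum_le_sum fun i _ =>
        (AddMonoidAlgebra.sup_support_pow_le zero_le subadditive _ _).trans <|
          (nsmul_le_nsmul_right (hY i) _).trans_eq (nsmul_one _)
  rw [MvPolynomial.aeval_def, MvPolynomial.eval₂_eq]
  refine AddMonoidAlgebra.supDegree_sum_le.trans (Finset.sup_le fun d hd => ?_)
  rw [MvPolynomial.algebraMap_apply, ← MvPolynomial.smul_eq_C_mul]
  exact (Finset.sup_mono MvPolynomial.support_smul).trans
    ((digitDegree_prod_le d).trans (MvPolynomial.le_totalDegree hd))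

end DigitSum

section TopCoefficient

variable {ι S : Type*} [CommRing S]

theorem coeff_add_mul_of_degrees_le {f g : MvPolynomial ι S} {b c : ι →₀ ℕ}
    (hf : f.degrees ≤ b.toMultiset) (hg : g.degrees ≤ c.toMultiset) :
    (f * g).coeff (b + c) = f.coeff b * g.coeff c := by
  classical
  exact AddMonoidAlgebra.coeff_add_of_supDegree_le (map_add Finsupp.toMultiset)
    Multiset.toFinsupp.symm.injective (by rwa [MvPolynomial.degrees_def] at hf)
    (by rwa [MvPolynomial.degrees_def] at hg)

theorem degrees_prod_le_toMultiset {α : Type*} {s : Finset α} {f : α → MvPolynomial ι S}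
    {b : α → ι →₀ ℕ} (h : ∀ a ∈ s, (f a).degrees ≤ (b a).toMultiset) :
    (∏ a ∈ s, f a).degrees ≤ (∑ a ∈ s, b a).toMultiset := by
  rw [map_sum]
  exact MvPolynomial.degrees_prod_le.trans (Finset.sum_le_sum h)

theorem coeff_sum_prod_of_degrees_le {α : Type*} {s : Finset α} {f : α → MvPolynomial ι S}
    {b : α → ι →₀ ℕ} (h : ∀ a ∈ s, (f a).degrees ≤ (b a).toMultiset) :
    (∏ a ∈ s, f a).coeff (∑ a ∈ s, b a) = ∏ a ∈ s, (f a).coeff (b a) := by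
  classical
  induction s using Finset.induction_on with
  | empty => simp
  | insert a s ha ih =>
    have hs : ∀ c ∈ s, (f c).degrees ≤ (b c).toMultiset := fun c hc =>
      h c (Finset.mem_insert_of_mem hc)
    rw [Finset.prod_insert ha, Finset.sum_insert ha, Finset.prod_insert ha, ← ih hs]
    exact coeff_add_mul_of_degrees_le (h a (Finset.mem_insert_self a s))
      (degrees_prod_le_toMultiset hs)

variable {m : Type*} [Fintype m] [DecidableEq m]
  {Y : Matrix m m (MvPolynomial ι S)} {b : m → ι →₀ ℕ}

theorem degrees_det_le (h : ∀ i j, (Y i j).degrees ≤ (b i).toMultiset) :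
    Y.det.degrees ≤ (∑ i, b i).toMultiset := by
  classical
  rw [Matrix.det_apply']
  refine (MvPolynomial.degrees_sum_le _ _).trans (Finset.sup_le fun τ _ => ?_)
  rw [← Equiv.sum_comp τ b, ← map_intCast (MvPolynomial.C : S →+* MvPolynomial ι S),
    ← MvPolynomial.smul_eq_C_mul, MvPolynomial.degrees_def]
  refine (Finset.sup_mono MvPolynomial.support_smul).trans ?_
  rw [← MvPolynomial.degrees_def]
  exact degrees_prod_le_toMultiset fun i _ => h (τ i) i

theorem coeff_det_of_degrees_le (h : ∀ i j, (Y i j).degrees ≤ (b i).toMultiset) :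
    Y.det.coeff (∑ i, b i) = (Matrix.of fun i j => (Y i j).coeff (b i)).det := by
  rw [Matrix.det_apply', Matrix.det_apply', MvPolynomial.coeff_sum]
  refine Finset.sum_congr rfl fun τ _ => ?_
  rw [← map_intCast (MvPolynomial.C : S →+* MvPolynomial ι S), MvPolynomial.coeff_C_mul,
    ← Equiv.sum_comp τ b, coeff_sum_prod_of_degrees_le fun i _ => h (τ i) i]
  rfl

theorem coeff_det_pow_of_degrees_le (h : ∀ i j, (Y i j).degrees ≤ (b i).toMultiset) (e : ℕ) :
    (Y.det ^ e).coeff (e • ∑ i, b i) = (Matrix.of fun i j => (Y i j).coeff (b i)).det ^ e := by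
  rw [← coeff_det_of_degrees_le h]
  simpa using coeff_sum_prod_of_degrees_le (s := Finset.range e) (f := fun _ => Y.det)
    fun _ _ => degrees_det_le h

end TopCoefficient

section Trace

variable {p : ℕ} {ι S : Type*} [CommRing S]

/-- The truncated trace `∑ (τ_l v)^(p^J)` over `J ≤ N`, with `τ_l = X l`. It replaces a
variable element of `𝔽_p`: the top coefficients do not see that it is not fixed by Frobenius. -/
noncomputable def traceSum (p N : ℕ) (l : ι) (v : S) : MvPolynomial ι S :=
  ∑ J ∈ Finset.range (N + 1), (MvPolynomial.X l * MvPolynomial.C v) ^ p ^ J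

theorem traceSum_eq_sum_monomial (N : ℕ) (l : ι) (v : S) :
    traceSum p N l v = ∑ J ∈ Finset.range (N + 1),
      MvPolynomial.monomial (Finsupp.single l (p ^ J)) (v ^ p ^ J) := by
  refine Finset.sum_congr rfl fun J _ => ?_
  rw [mul_pow, ← map_pow, MvPolynomial.X_pow_eq_monomial, mul_comm, MvPolynomial.C_mul_monomial,
    mul_one]

theorem digitDegree_traceSum_le (hp : 1 < p) (N : ℕ) (l l' : ι) (v : S) :
    digitDegree p l' (traceSum p N l v) ≤ 1 := by
  classical
  rw [traceSum_eq_sum_monomial]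
  refine AddMonoidAlgebra.supDegree_sum_le.trans (Finset.sup_le fun J _ => ?_)
  refine Finset.sup_le fun k hk => ?_
  obtain rfl := Finset.mem_singleton.1 (MvPolynomial.support_monomial_subset hk)
  rw [Finsupp.single_apply]
  split_ifs
  · exact (digits_sum_pow hp J).le
  · simp

theorem degrees_traceSum_le (hp : 0 < p) (N : ℕ) (l : ι) (v : S) :
    (traceSum p N l v).degrees ≤ (Finsupp.single l (p ^ N)).toMultiset := by
  classical
  rw [traceSum_eq_sum_monomial]
  refine (MvPolynomial.degrees_sum_le _ _).trans (Finset.sup_le fun J hJ => ?_)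
  refine (MvPolynomial.degrees_monomial _ _).trans (Finsupp.toMultiset_strictMono.monotone ?_)
  exact Finsupp.single_mono (Nat.pow_le_pow_right hp (Finset.mem_range_succ_iff.1 hJ))

theorem coeff_traceSum (hp : 1 < p) (N : ℕ) (l : ι) (v : S) :
    (traceSum p N l v).coeff (Finsupp.single l (p ^ N)) = v ^ p ^ N := by
  classical
  simp [traceSum_eq_sum_monomial, MvPolynomial.coeff_sum, MvPolynomial.coeff_monomial,
    (Finsupp.single_injective l).eq_iff, (Nat.pow_right_injective hp).eq_iff]

theorem traceSum_pow_sub_self [Fact p.Prime] [CharP S p] (N : ℕ) (l : ι) (v : S) :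
    traceSum p N l v ^ p - traceSum p N l v =
      (MvPolynomial.X l * MvPolynomial.C v) ^ p ^ (N + 1) -
        MvPolynomial.X l * MvPolynomial.C v := by
  rw [traceSum, sum_pow_char, ← Finset.sum_sub_distrib]
  simp only [← pow_mul, ← pow_succ]
  rw [Finset.sum_range_sub fun J => (MvPolynomial.X l * MvPolynomial.C v) ^ p ^ J]
  simp

/- `(X l * C v) ^ p ^ (N + 1)` has too large a degree in `X l` to contribute, and the other term
would require the exponent `(p - 1) * p ^ N - 1`, of digit sum at least `N`, to occur in `w`. -/
theorem coeff_mul_traceSum_pow_sub_self [Fact p.Prime] [CharP S p] {N : ℕ} {l : ι}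
    {w : MvPolynomial ι S} (hw : digitDegree p l w < N) (v : S) {b : ι →₀ ℕ}
    (hb : b l = (p - 1) * p ^ N) :
    (w * (traceSum p N l v ^ p - traceSum p N l v)).coeff b = 0 := by
  classical
  have hp : p.Prime := Fact.out
  have hp_sub_one : 0 < p - 1 := Nat.sub_pos_of_lt hp.one_lt
  have hb_pos : b l ≠ 0 := hb ▸ (Nat.mul_pos hp_sub_one (pow_pos hp.pos _)).ne'
  have coeff_high : (w * (MvPolynomial.X l * MvPolynomial.C v) ^ p ^ (N + 1)).coeff b = 0 := by
    rw [mul_pow, mul_left_comm, MvPolynomial.X_pow_eq_monomial, MvPolynomial.coeff_monomial_mul',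
      if_neg]
    rw [Finsupp.single_le_iff, hb, pow_succ', not_le]
    exact Nat.mul_lt_mul_of_pos_right (Nat.sub_lt hp.pos one_pos) (pow_pos hp.pos N)
  have coeff_low : (w * (MvPolynomial.X l * MvPolynomial.C v)).coeff b = 0 := by
    rw [mul_left_comm, MvPolynomial.coeff_X_mul', if_pos (Finsupp.mem_support_iff.2 hb_pos),
      mul_comm, MvPolynomial.coeff_C_mul]
    by_contra hne
    have digits_le := digits_sum_le_digitDegree (p := p) (l := l) (right_ne_zero_of_mul hne)
    rw [Finsupp.tsub_apply, hb, Finsupp.single_eq_same] at digits_le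
    exact (hw.trans_le (le_digits_sum_mul_pow_sub_one hp.one_lt hp_sub_one N)).not_ge digits_le
  rw [traceSum_pow_sub_self, mul_sub, MvPolynomial.coeff_sub, coeff_high, coeff_low, sub_zero]

end Trace

section Nullstellensatz

variable {F : Type*} [Field F] [Fintype F]

theorem prod_X_sub_C_eq_X_pow_card_sub_X :
    ∏ a : F, (X - C a) = (X ^ Fintype.card F - X : F[X]) := by
  have roots_eq := FiniteField.roots_X_pow_card_sub_X F
  have monic : (X ^ Fintype.card F - X : F[X]).Monic :=
    monic_X_pow_sub (by rw [degree_X]; exact_mod_cast Fintype.one_lt_card)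
  rw [← prod_multiset_X_sub_C_of_monic_of_roots_card_eq monic, roots_eq]
  · rfl
  · rw [roots_eq, FiniteField.X_pow_card_sub_X_natDegree_eq _ Fintype.one_lt_card]
    rfl

theorem exists_eq_sum_mul_pow_card_sub {κ A : Type*} [Finite κ] [CommRing A] [IsDomain A]
    [Algebra F A] (f : MvPolynomial κ A)
    (hf : ∀ Y : κ → F, MvPolynomial.eval (fun i => algebraMap F A (Y i)) f = 0) :
    ∃ h : κ →₀ MvPolynomial κ A,
      f = h.sum fun i g => g * (MvPolynomial.X i ^ Fintype.card F - MvPolynomial.X i) := by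
  classical
  have prod_eq (i : κ) : ∏ r ∈ Finset.univ.image (algebraMap F A),
      (MvPolynomial.X i - MvPolynomial.C r) =
        MvPolynomial.X (R := A) i ^ Fintype.card F - MvPolynomial.X i := by
    rw [Finset.prod_image (algebraMap F A).injective.injOn]
    have prod_eq := congrArg (aeval (MvPolynomial.X i : MvPolynomial κ A))
      (prod_X_sub_C_eq_X_pow_card_sub_X (F := F))
    simp only [map_prod, map_sub, map_pow, aeval_X, aeval_C] at prod_eq
    exact prod_eq
  obtain ⟨h, -, hf_eq⟩ := MvPolynomial.combinatorial_nullstellensatz_exists_linearCombination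
    (fun _ : κ => Finset.univ.image (algebraMap F A)) (fun _ => by simp) f fun x hx => by
      choose Y _ hY using fun i => Finset.mem_image.1 (hx i)
      simpa only [hY] using hf Y
  refine ⟨h, ?_⟩
  simpa only [prod_eq, Finsupp.linearCombination_apply, smul_eq_mul] using hf_eq

end Nullstellensatz

section TraceSubstitution

variable {p : ℕ} [Fact p.Prime] {ι A S : Type*} [CommRing A]
  [Algebra (ZMod p) A] [CommRing S]

theorem exists_coeff_aeval_traceSum_eq_zero [IsDomain A] [CharP S p] [Algebra A S] {κ : Type*}
    [Finite κ] {g : MvPolynomial κ A}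
    (hg : ∀ Y : κ → ZMod p, MvPolynomial.eval (fun i => algebraMap (ZMod p) A (Y i)) g = 0)
    (l : κ → ι) (y : κ → S) :
    ∃ K : ℕ, ∀ (N : ι → ℕ) (b : ι →₀ ℕ), (∀ i, K ≤ N i) → (∀ i, b i = (p - 1) * p ^ N i) →
      (MvPolynomial.aeval (fun i => traceSum p (N (l i)) (l i) (y i)) g).coeff b = 0 := by
  obtain ⟨h, rfl⟩ := exists_eq_sum_mul_pow_card_sub g hg
  refine ⟨(h.support.sup fun i => (h i).totalDegree) + 1, fun N b hN hb => ?_⟩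
  rw [Finsupp.sum, map_sum, MvPolynomial.coeff_sum]
  refine Finset.sum_eq_zero fun i hi => ?_
  rw [map_mul, map_sub, map_pow, MvPolynomial.aeval_X, ZMod.card]
  refine coeff_mul_traceSum_pow_sub_self ?_ (y i) (hb (l i))
  calc digitDegree p (l i) _
      ≤ (h i).totalDegree := digitDegree_aeval_le
        (fun _ => digitDegree_traceSum_le (Fact.out : p.Prime).one_lt _ _ _ _) (h i)
    _ ≤ h.support.sup fun i => (h i).totalDegree :=
        Finset.le_sup (f := fun i => (h i).totalDegree) hi
    _ < N (l i) := hN (l i)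

variable [Fintype ι] [DecidableEq ι]

theorem coeff_det_traceSum_pow {p : ℕ} (hp : 1 < p) (N : ι → ℕ) (y : ι → S) (e : ℕ) :
    ((Matrix.of fun l i => traceSum p (N l) l (y i)).det ^ e).coeff
      (e • ∑ l, Finsupp.single l (p ^ N l)) = (Matrix.of fun l i => y i ^ p ^ N l).det ^ e := by
  rw [coeff_det_pow_of_degrees_le fun l i => by
    exact degrees_traceSum_le (by omega) (N l) l (y i)]
  simp only [Matrix.of_apply, coeff_traceSum hp]

theorem eval_C_mul_det_mvPolynomialX_pow (r : A) (Y : Matrix ι ι (ZMod p)) :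
    MvPolynomial.eval (fun i => algebraMap (ZMod p) A (Y i.1 i.2))
        (MvPolynomial.C r * (Matrix.mvPolynomialX ι ι A).det ^ (p - 1)) =
      if Y.det = 0 then 0 else r := by
  have eval_det : MvPolynomial.eval (fun i => algebraMap (ZMod p) A (Y i.1 i.2))
      (Matrix.mvPolynomialX ι ι A).det = algebraMap (ZMod p) A Y.det := by
    rw [RingHom.map_det, RingHom.map_det]
    exact congrArg _ (Matrix.mvPolynomialX_mapMatrix_eval (Y.map (algebraMap (ZMod p) A)))
  rw [map_mul, map_pow, eval_det, MvPolynomial.eval_C, ← map_pow]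
  split_ifs with det_eq_zero
  · simp [det_eq_zero, Nat.sub_ne_zero_of_lt (Fact.out : p.Prime).one_lt]
  · simp [ZMod.pow_card_sub_one_eq_one det_eq_zero]

theorem exists_coeff_aeval_traceSum_eq_det_pow [IsDomain A] [CharP S p] [Algebra A S]
    {g : MvPolynomial (ι × ι) A} {r : A}
    (hg : ∀ Y : Matrix ι ι (ZMod p),
      MvPolynomial.eval (fun i => algebraMap (ZMod p) A (Y i.1 i.2)) g =
        if Y.det = 0 then 0 else r) (y : ι → S) :
    ∃ K : ℕ, ∀ N : ι → ℕ, (∀ l, K ≤ N l) →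
      (MvPolynomial.aeval (fun i : ι × ι => traceSum p (N i.1) i.1 (y i.2)) g).coeff
        ((p - 1) • ∑ l, Finsupp.single l (p ^ N l)) =
      r • (Matrix.of fun l i => y i ^ p ^ N l).det ^ (p - 1) := by
  set detPow := MvPolynomial.C r * (Matrix.mvPolynomialX ι ι A).det ^ (p - 1)
  have vanishes (Y : ι × ι → ZMod p) :
      MvPolynomial.eval (fun i => algebraMap (ZMod p) A (Y i)) (g - detPow) = 0 := by
    rw [map_sub, sub_eq_zero]
    exact (hg (Function.curry Y)).trans
      (eval_C_mul_det_mvPolynomialX_pow r (Function.curry Y)).symm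
  obtain ⟨K, hK⟩ := exists_coeff_aeval_traceSum_eq_zero vanishes Prod.fst fun i => y i.2
  refine ⟨K, fun N hN => ?_⟩
  have coeff_eq := hK N ((p - 1) • ∑ l, Finsupp.single l (p ^ N l)) hN fun l => by
    simp [Finsupp.single_apply]
  have aeval_det : MvPolynomial.aeval (fun i : ι × ι => traceSum p (N i.1) i.1 (y i.2))
      (Matrix.mvPolynomialX ι ι A).det = (Matrix.of fun l i => traceSum p (N l) l (y i)).det := by
    rw [AlgHom.map_det]
    exact congrArg _ (Matrix.mvPolynomialX_mapMatrix_aeval A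
      (Matrix.of fun l i => traceSum p (N l) l (y i)))
  rw [map_sub, MvPolynomial.coeff_sub, sub_eq_zero] at coeff_eq
  rw [coeff_eq, map_mul, map_pow, aeval_det, MvPolynomial.algHom_C, MvPolynomial.algebraMap_apply,
    MvPolynomial.coeff_C_mul, coeff_det_traceSum_pow (Fact.out : p.Prime).one_lt,
    Algebra.smul_def]

end TraceSubstitution

section HyperplaneCount

variable {K V W : Type*} [Field K] [AddCommGroup V] [Module K V] [AddCommGroup W] [Module K W]

theorem ker_eq_span_singleton_of_disjoint_ker {η : Module.Dual K V} {Y : V →ₗ[K] W} {v : V}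
    (hv : v ≠ 0) (hvY : Y v = 0) (h : Disjoint η.ker Y.ker) : Y.ker = K ∙ v := by
  have eq_zero (w : V) (hη : η w = 0) (hY : Y w = 0) : w = 0 :=
    Submodule.disjoint_def.1 h w hη hY
  have hηv : η v ≠ 0 := fun hη => hv (eq_zero v hη hvY)
  refine le_antisymm (fun w hw => ?_) ((Submodule.span_singleton_le_iff_mem v _).2 hvY)
  refine Submodule.mem_span_singleton.2 ⟨η w / η v, (sub_eq_zero.1 (eq_zero _ ?_ ?_)).symm⟩
  · simp [hηv]
  · rw [map_sub, map_smul, hvY, smul_zero, sub_zero, hw]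

variable [Finite K]

theorem cast_natCard_eq_zero [FiniteDimensional K V] (hV : Module.finrank K V ≠ 0) :
    (Nat.card V : K) = 0 := by
  have := Fintype.ofFinite K
  rw [Module.natCard_eq_pow_finrank (K := K), Nat.cast_pow, Nat.card_eq_fintype_card,
    FiniteField.cast_card_eq_zero, zero_pow hV]

variable [FiniteDimensional K V]

open Classical in
theorem sum_dual_ite_apply_ne_zero [Fintype (Module.Dual K V)] (hV : 2 ≤ Module.finrank K V)
    (v : V) : ∑ η : Module.Dual K V, (if η v ≠ 0 then 1 else 0 : K) = 0 := by
  let evalAt : Module.Dual K V →ₗ[K] K := Module.Dual.eval K V v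
  have finrank_ker : Module.finrank K evalAt.ker ≠ 0 := by
    have rank_nullity := evalAt.finrank_range_add_finrank_ker
    have := (Submodule.finrank_le evalAt.range).trans_eq (Module.finrank_self K)
    rw [Subspace.dual_finrank_eq] at rank_nullity
    omega
  have card_ker : (Nat.card evalAt.ker : K) = 0 := cast_natCard_eq_zero finrank_ker
  have card_dual : (Nat.card (Module.Dual K V) : K) = 0 :=
    cast_natCard_eq_zero (by rw [Subspace.dual_finrank_eq]; omega)
  have sum_ker : ∑ η : Module.Dual K V, (if η v = 0 then 1 else 0 : K) = Nat.card evalAt.ker := by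
    rw [Finset.sum_boole, Nat.card_eq_fintype_card, Fintype.card_subtype]
    rfl
  have (η : Module.Dual K V) :
      (if η v ≠ 0 then 1 else 0 : K) = 1 - if η v = 0 then 1 else 0 := by
    split_ifs <;> simp_all
  simp only [this, Finset.sum_sub_distrib, sum_ker, card_ker, Finset.sum_const, Finset.card_univ,
    nsmul_one, sub_zero]
  rw [← Nat.card_eq_fintype_card, card_dual]

open Classical in
theorem sum_dual_ite_injective_domRestrict_ker [Fintype (Module.Dual K V)]
    (hV : 2 ≤ Module.finrank K V) (Y : V →ₗ[K] W) :
    ∑ η : Module.Dual K V,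
        (if η ≠ 0 ∧ Function.Injective (Y.domRestrict η.ker) then 1 else 0 : K) =
      -if Function.Injective Y then 1 else 0 := by
  by_cases hY : Function.Injective Y
  · have (η : Module.Dual K V) : Function.Injective (Y.domRestrict η.ker) :=
      hY.comp Subtype.val_injective
    have card_dual : (Nat.card (Module.Dual K V) : K) = 0 :=
      cast_natCard_eq_zero (by rw [Subspace.dual_finrank_eq]; omega)
    have ite_ne (η : Module.Dual K V) :
        (if η ≠ 0 then 1 else 0 : K) = 1 - if η = 0 then 1 else 0 := by
      split_ifs <;> simp_all
    simp only [this, hY, and_true, if_true, ite_ne, Finset.sum_sub_distrib, Finset.sum_ite_eq',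
      Finset.mem_univ, Finset.sum_const, Finset.card_univ, nsmul_one, ← Nat.card_eq_fintype_card,
      card_dual, zero_sub]
  rw [if_neg hY, neg_zero]
  obtain ⟨v, hvY, hv⟩ : ∃ v, Y v = 0 ∧ v ≠ 0 := by
    simpa [injective_iff_map_eq_zero] using hY
  simp only [LinearMap.injective_domRestrict_iff]
  by_cases exists_disjoint : ∃ η : Module.Dual K V, Disjoint η.ker Y.ker
  · obtain ⟨η₀, hη₀⟩ := exists_disjoint
    have ker_eq := ker_eq_span_singleton_of_disjoint_ker hv hvY hη₀
    have disjoint_iff (η : Module.Dual K V) : (η ≠ 0 ∧ Disjoint η.ker Y.ker) ↔ η v ≠ 0 := by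
      rw [ker_eq, Submodule.disjoint_span_singleton' hv, LinearMap.mem_ker]
      exact and_iff_right_of_imp fun h h0 => h (by rw [h0, LinearMap.zero_apply])
    simpa only [disjoint_iff] using sum_dual_ite_apply_ne_zero hV v
  · exact Finset.sum_eq_zero fun η _ => if_neg fun h => exists_disjoint ⟨η, h.2⟩

open Classical in
theorem ite_injective_mem_span (W : Type*) [AddCommGroup W] [Module K W] {d : ℕ} (hd : 1 ≤ d)
    (hV : d ≤ Module.finrank K V) :
    (fun Y : V →ₗ[K] W => if Function.Injective Y then (1 : K) else 0) ∈
      Submodule.span K (Set.range fun (u : (Fin d → K) →ₗ[K] V) (Y : V →ₗ[K] W) =>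
        if Function.Injective (Y ∘ₗ u) then (1 : K) else 0) := by
  obtain ⟨m, hm⟩ := Nat.exists_eq_add_of_le hV
  induction m generalizing V with
  | zero =>
    let e : (Fin d → K) ≃ₗ[K] V := LinearEquiv.ofFinrankEq _ _ (by simp [hm])
    refine Submodule.subset_span ⟨e, funext fun Y => ?_⟩
    simp only [LinearMap.coe_comp, LinearEquiv.coe_coe, EquivLike.injective_comp]
  | succ m ih =>
    have := Module.finite_of_finite K (M := Module.Dual K V)
    have := Fintype.ofFinite (Module.Dual K V)
    have expand : (fun Y : V →ₗ[K] W => if Function.Injective Y then (1 : K) else 0) =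
        -∑ η : Module.Dual K V, fun Y : V →ₗ[K] W =>
          if η ≠ 0 ∧ Function.Injective (Y.domRestrict η.ker) then 1 else 0 := by
      funext Y
      rw [Pi.neg_apply, Finset.sum_apply, sum_dual_ite_injective_domRestrict_ker (by omega),
        neg_neg]
    rw [expand]
    refine Submodule.neg_mem _ (Submodule.sum_mem _ fun η _ => ?_)
    by_cases hη : η = 0
    · simp only [hη, ne_eq, not_true_eq_false, false_and, if_false]
      exact Submodule.zero_mem _
    have finrank_ker := Module.Dual.finrank_ker_add_one_of_ne_zero hη
    have restrict := Submodule.mem_map_of_mem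
      (f := LinearMap.funLeft K K fun Y : V →ₗ[K] W => Y.domRestrict η.ker)
      (ih (V := η.ker) (by omega) (by omega))
    rw [Submodule.map_span, ← Set.range_comp] at restrict
    simp only [ne_eq, hη, not_false_eq_true, true_and]
    refine Submodule.span_mono ?_ restrict
    rintro _ ⟨u, rfl⟩
    exact ⟨η.ker.subtype ∘ₗ u, rfl⟩

end HyperplaneCount

section Orbits

open scoped Matrix

theorem exists_mul_eq_of_linearIndependent_row {m n K : Type*} [Finite m] [Fintype n]
    [DecidableEq n] [Field K] {M M' : Matrix m n K} (hM : LinearIndependent K M.row)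
    (hM' : LinearIndependent K M'.row) : ∃ g : GL n K, M * (g : Matrix n n K) = M' := by
  have := Fintype.ofFinite m
  rw [← Matrix.vecMul_injective_iff] at hM hM'
  let toRange := LinearEquiv.ofInjective M.vecMulLinear hM
  obtain ⟨e, he⟩ := Submodule.exists_linearEquiv_restrict_eq
    (toRange.symm.trans (LinearEquiv.ofInjective M'.vecMulLinear hM'))
  let G : Matrix n n K := LinearMap.toMatrixRight' e.toLinearMap
  have vecMul_G (v : n → K) : v ᵥ* G = e v :=
    LinearMap.congr_fun (LinearMap.toMatrixRight'.symm_apply_apply e.toLinearMap) v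
  have isUnit_G : IsUnit G := by
    rw [← Matrix.vecMul_injective_iff_isUnit]
    exact fun v w h => e.injective (by simpa only [vecMul_G] using h)
  refine ⟨isUnit_G.unit, Matrix.vecMul_injective (funext fun v => ?_)⟩
  have := he (toRange v)
  rw [LinearEquiv.trans_apply, LinearEquiv.symm_apply_apply] at this
  calc v ᵥ* (M * G) = e (v ᵥ* M) := by rw [← Matrix.vecMul_vecMul, vecMul_G]
    _ = v ᵥ* M' := this.symm

theorem exists_mul_eq_of_not_linearIndependent_row {m n K : Type*} [Fintype m] [Finite n]
    [Field K] {M : Matrix m n K} (hM : ¬LinearIndependent K M.row) :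
    ∃ r < Fintype.card m, ∃ (B : Matrix m (Fin r) K) (C : Matrix (Fin r) n K), M = B * C := by
  let b := Module.finBasis K (Submodule.span K (Set.range M.row))
  have mem_span (i : m) : M.row i ∈ Submodule.span K (Set.range M.row) :=
    Submodule.subset_span ⟨i, rfl⟩
  refine ⟨_, not_le.1 (mt linearIndependent_iff_card_le_finrank_span.2 hM),
    Matrix.of fun i => b.repr ⟨M.row i, mem_span i⟩, Matrix.of fun k => b k, ?_⟩
  ext i j
  calc M i j = (∑ k, b.repr ⟨M.row i, mem_span i⟩ k • b k : Submodule.span K _).1 j := by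
        rw [b.sum_repr]
        rfl
    _ = ∑ k, b.repr ⟨M.row i, mem_span i⟩ k * (b k : n → K) j := by
        simp only [Submodule.coe_sum, Submodule.coe_smul, Finset.sum_apply, Pi.smul_apply,
          smul_eq_mul]

variable {k : Type*} [CommSemiring k] {l m n : Type*} [Fintype l] [Fintype m]

/-- The pullback of polynomial functions along the linear map `t ↦ t M` of row vectors; for a square
matrix over `ZMod p` this is `subst`. -/
noncomputable def pullback (M : Matrix m n k) : MvPolynomial n k →ₐ[k] MvPolynomial m k :=
  MvPolynomial.aeval fun j => ∑ i, M i j • MvPolynomial.X i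

@[simp]
theorem pullback_X (M : Matrix m n k) (j : n) :
    pullback M (MvPolynomial.X j) = ∑ i, M i j • MvPolynomial.X i :=
  MvPolynomial.aeval_X _ j

theorem pullback_one [DecidableEq m] : pullback (1 : Matrix m m k) = AlgHom.id k _ := by
  ext1 j
  simp [Matrix.one_apply]

theorem pullback_mul (B : Matrix l m k) (C : Matrix m n k) :
    pullback (B * C) = (pullback B).comp (pullback C) := by
  ext1 j
  simp only [pullback_X, AlgHom.comp_apply, map_sum, map_smul, Matrix.mul_apply, Finset.smul_sum,
    Finset.sum_smul, smul_smul]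
  rw [Finset.sum_comm]
  simp only [mul_comm]

theorem pullback_of_isEmpty [IsEmpty m] (M : Matrix m n k) (x : MvPolynomial n k) :
    pullback M x = MvPolynomial.C (MvPolynomial.constantCoeff x) := by
  simp only [pullback, Finset.univ_eq_empty, Finset.sum_empty, MvPolynomial.aeval_zero',
    MvPolynomial.algebraMap_eq]

variable {p : ℕ} [Fact p.Prime] {n : ℕ} {x : MvPolynomial (Fin n) (ZMod p)}

theorem pullback_eq_pullback_of_linearIndependent_row (hx : x ∈ invariants p n)
    {M M' : Matrix m (Fin n) (ZMod p)} (hM : LinearIndependent (ZMod p) M.row)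
    (hM' : LinearIndependent (ZMod p) M'.row) : pullback M x = pullback M' x := by
  obtain ⟨g, rfl⟩ := exists_mul_eq_of_linearIndependent_row hM hM'
  rw [pullback_mul, AlgHom.comp_apply]
  exact congrArg _ (mem_invariants.1 hx g).symm

open Classical in
theorem exists_pullback_eq_ite (hx : x ∈ augmentation p n) (hx0 : x ≠ 0) :
    ∃ d, 1 ≤ d ∧ d ≤ n ∧ ∃ r : MvPolynomial (Fin d) (ZMod p), r ≠ 0 ∧
      ∀ M : Matrix (Fin d) (Fin n) (ZMod p),
        pullback M x = if LinearIndependent (ZMod p) M.row then r else 0 := by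
  have exists_ne_zero : ∃ d, ∃ M : Matrix (Fin d) (Fin n) (ZMod p), pullback M x ≠ 0 :=
    ⟨n, 1, by rwa [pullback_one]⟩
  obtain ⟨M₀, hM₀⟩ := Nat.find_spec exists_ne_zero
  have eq_zero {M : Matrix (Fin (Nat.find exists_ne_zero)) (Fin n) (ZMod p)}
      (hM : ¬LinearIndependent (ZMod p) M.row) : pullback M x = 0 := by
    obtain ⟨r, hr, B, C, rfl⟩ := exists_mul_eq_of_not_linearIndependent_row hM
    rw [Fintype.card_fin] at hr
    have pullback_C : pullback C x = 0 := by
      by_contra h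
      exact Nat.find_min exists_ne_zero hr ⟨C, h⟩
    rw [pullback_mul, AlgHom.comp_apply, pullback_C, map_zero]
  have independent : LinearIndependent (ZMod p) M₀.row := not_not.1 (mt eq_zero hM₀)
  refine ⟨Nat.find exists_ne_zero, ?_, by simpa using independent.fintype_card_le_finrank,
    pullback M₀ x, hM₀, fun M => ?_⟩
  · rw [Nat.one_le_iff_ne_zero, Ne, Nat.find_eq_zero]
    rintro ⟨M, hM⟩
    exact hM (by rw [pullback_of_isEmpty, hx.2, map_zero])
  · split_ifs with hM
    · exact pullback_eq_pullback_of_linearIndependent_row hx.1 hM independent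
    · exact eq_zero hM

end Orbits

section Moore

theorem det_X_pow_ne_zero {ι R : Type*} [Fintype ι] [DecidableEq ι] [CommRing R] [Nontrivial R]
    {a : ι → ℕ} (ha : Function.Injective a) :
    (Matrix.of fun l i => (MvPolynomial.X i ^ a l : MvPolynomial ι R)).det ≠ 0 := by
  have prod_eq (τ : Equiv.Perm ι) : ∏ i, (MvPolynomial.X i ^ a (τ i) : MvPolynomial ι R) =
      MvPolynomial.monomial (Finsupp.equivFunOnFinite.symm (a ∘ τ)) 1 := by
    rw [MvPolynomial.monomial_eq, Finsupp.prod_pow, MvPolynomial.C_1, one_mul]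
    rfl
  have diagonal_coeff : MvPolynomial.coeff (Finsupp.equivFunOnFinite.symm a)
      (Matrix.of fun l i => (MvPolynomial.X i ^ a l : MvPolynomial ι R)).det = 1 := by
    rw [Matrix.det_apply, MvPolynomial.coeff_sum, Finset.sum_eq_single 1]
    · simpa using congrArg (MvPolynomial.coeff (Finsupp.equivFunOnFinite.symm a)) (prod_eq 1)
    · intro τ _ hτ
      have exponent_ne : Finsupp.equivFunOnFinite.symm (a ∘ τ) ≠
          Finsupp.equivFunOnFinite.symm a := fun h =>
        hτ (Equiv.ext fun i => ha (congrFun (Finsupp.equivFunOnFinite.symm.injective h) i))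
      simp only [Matrix.of_apply, prod_eq, MvPolynomial.coeff_smul, MvPolynomial.coeff_monomial,
        if_neg exponent_ne, smul_zero]
    · simp
  intro h
  rw [h, MvPolynomial.coeff_zero] at diagonal_coeff
  exact zero_ne_one diagonal_coeff

variable {p : ℕ} [Fact p.Prime]

theorem coeff_aeval_sum_traceSum_mem_scalarExtension {σ ι A : Type*} [Fintype ι] [CommRing A]
    [Algebra (ZMod p) A] {N : Submodule (SteenrodAlgebra p) (MvPolynomial σ (ZMod p))}
    {x : MvPolynomial σ (ZMod p)} {m : ℕ} (hx : x ∈ N) (hm : x.IsHomogeneous m) (r : ι → A)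
    (E : ι → ℕ) (b : ι →₀ ℕ) :
    (MvPolynomial.aeval (fun i => ∑ l, MvPolynomial.C (MvPolynomial.C (r l)) *
      traceSum p (E l) l (MvPolynomial.X i)) x).coeff b ∈
        scalarExtension (N.restrictScalars (ZMod p)) A := by
  let M := Finset.univ.sup E
  let coef (J : ℕ) : MvPolynomial ι A :=
    ∑ l, if J ∈ Finset.range (E l + 1) then MvPolynomial.C (r l) * MvPolynomial.X l ^ p ^ J else 0
  let swap : MvPolynomial σ (MvPolynomial ι A) →ₐ[ZMod p] MvPolynomial ι (MvPolynomial σ A) :=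
    (MvPolynomial.commAlgEquiv A σ ι).toAlgHom.restrictScalars (ZMod p)
  have swap_additivePolynomial (i : σ) : swap (additivePolynomial p (M + 1) coef i) =
      ∑ l, MvPolynomial.C (MvPolynomial.C (r l)) *
        traceSum p (E l) l (MvPolynomial.X (R := A) i) := by
    have term (J : ℕ) : swap (MvPolynomial.C (coef J) * MvPolynomial.X i ^ p ^ J) =
        ∑ l, if J ∈ Finset.range (E l + 1) then MvPolynomial.C (MvPolynomial.C (r l)) *
          (MvPolynomial.X l * MvPolynomial.C (MvPolynomial.X i)) ^ p ^ J else 0 := by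
      change MvPolynomial.commAlgEquiv A σ ι _ = _
      rw [map_mul, map_pow, MvPolynomial.commAlgEquiv_X, MvPolynomial.commAlgEquiv_C, map_sum,
        Finset.sum_mul]
      refine Finset.sum_congr rfl fun l _ => ?_
      split_ifs
      · simp only [map_mul, map_pow, MvPolynomial.map_C, MvPolynomial.map_X, mul_pow, mul_assoc]
      · rw [map_zero, zero_mul]
    have range_subset (l : ι) : Finset.range (E l + 1) ⊆ Finset.range (M + 1) :=
      Finset.range_subset_range.2 (by grind [Finset.le_sup (f := E) (Finset.mem_univ l)])
    rw [additivePolynomial, map_sum, Finset.sum_congr rfl fun J _ => term J, Finset.sum_comm]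
    refine Finset.sum_congr rfl fun l _ => ?_
    rw [Finset.sum_ite_mem, Finset.inter_eq_right.2 (range_subset l), traceSum, Finset.mul_sum]
  have swapped : (swap (MvPolynomial.aeval (additivePolynomial p (M + 1) coef) x)).coeff b ∈
      scalarExtension (N.restrictScalars (ZMod p)) A := coeff_commAlgEquiv_mem_scalarExtension
    (aeval_additivePolynomial_mem_scalarExtension hx hm M coef) b
  rw [MvPolynomial.comp_aeval_apply] at swapped
  simpa only [swap_additivePolynomial] using swapped

end Moore

section MooreDeterminant

open Classical in
theorem exists_sum_ite_linearIndependent_mul {K : Type*} [Field K] [Fintype K] {d m n : ℕ}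
    (hd : 1 ≤ d) (hdm : d ≤ m) : ∃ c : Matrix (Fin d) (Fin m) K → K,
      ∀ Y : Matrix (Fin m) (Fin n) K,
        ∑ u, c u * (if LinearIndependent K (u * Y).row then 1 else 0) =
          if LinearIndependent K Y.row then 1 else 0 := by
  have mem_span := ite_injective_mem_span (K := K) (V := Fin m → K) (Fin n → K) hd
    (hdm.trans_eq (Module.finrank_fin_fun K).symm)
  rw [← (LinearMap.toMatrixRight' (R := K) (m := Fin d) (n := Fin m)).symm.surjective.range_comp,
    Submodule.mem_span_range_iff_exists_fun] at mem_span
  obtain ⟨c, hc⟩ := mem_span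
  have injective_iff {l : ℕ} (M : Matrix (Fin l) (Fin n) K) :
      Function.Injective M.vecMulLinear ↔ LinearIndependent K M.row := Matrix.vecMul_injective_iff
  have comp_eq (u : Matrix (Fin d) (Fin m) K) (Y : Matrix (Fin m) (Fin n) K) :
      Y.vecMulLinear ∘ₗ LinearMap.toMatrixRight'.symm u = (u * Y).vecMulLinear :=
    (Matrix.toLinearMapRight'_mul u Y).symm
  refine ⟨c, fun Y => ?_⟩
  simpa only [Finset.sum_apply, Pi.smul_apply, Function.comp_apply, smul_eq_mul, comp_eq,
    injective_iff] using congrFun hc Y.vecMulLinear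

theorem aeval_aeval_sum_C_mul_X {k A T σ ι : Type*} [Fintype ι] [CommSemiring k] [CommSemiring A]
    [CommSemiring T] [Algebra k A] [Algebra A T] [Algebra k T] [IsScalarTower k A T] (s : ι → A)
    (f : ι × σ → T) (x : MvPolynomial σ k) :
    MvPolynomial.aeval f (MvPolynomial.aeval
        (fun i => ∑ l, MvPolynomial.C (s l) * MvPolynomial.X (l, i)) x) =
      MvPolynomial.aeval (fun i => ∑ l, algebraMap A T (s l) * f (l, i)) x := by
  rw [← AlgHom.restrictScalars_apply k, MvPolynomial.comp_aeval_apply]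
  simp

variable {p : ℕ} [Fact p.Prime] {n : ℕ} {x : MvPolynomial (Fin n) (ZMod p)}

theorem eval_aeval_sum_C_pullback_mul_X {k ι κ : Type*} [Fintype ι] [Fintype κ] [CommSemiring k]
    {n : Type*} (u : Matrix κ ι k) (Y : Matrix ι n k) (x : MvPolynomial n k) :
    MvPolynomial.eval (fun i => algebraMap k (MvPolynomial κ k) (Y i.1 i.2))
        (MvPolynomial.aeval (fun i =>
          ∑ l, MvPolynomial.C (pullback u (MvPolynomial.X l)) * MvPolynomial.X (l, i)) x) =
      pullback (u * Y) x := by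
  rw [← MvPolynomial.aeval_eq_eval, aeval_aeval_sum_C_mul_X, pullback_mul, AlgHom.comp_apply]
  change _ = pullback u (MvPolynomial.aeval (fun j => ∑ l, Y l j • MvPolynomial.X l) x)
  rw [MvPolynomial.comp_aeval_apply]
  simp [Algebra.smul_def, mul_comm]

theorem exists_eval_eq_ite_det (hx : x ∈ augmentation p n) (hx0 : x ≠ 0) :
    ∃ (d : ℕ) (r : MvPolynomial (Fin d) (ZMod p)) (c : Matrix (Fin d) (Fin n) (ZMod p) → ZMod p),
      r ≠ 0 ∧ ∀ Y : Matrix (Fin n) (Fin n) (ZMod p),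
        MvPolynomial.eval (fun i => algebraMap (ZMod p) (MvPolynomial (Fin d) (ZMod p)) (Y i.1 i.2))
          (∑ u, c u • MvPolynomial.aeval (fun i =>
            ∑ l, MvPolynomial.C (pullback u (MvPolynomial.X l)) * MvPolynomial.X (l, i)) x) =
          if Y.det = 0 then 0 else r := by
  classical
  obtain ⟨d, hd, hdn, r, hr, pullback_eq⟩ := exists_pullback_eq_ite hx hx0
  obtain ⟨c, hc⟩ := exists_sum_ite_linearIndependent_mul (K := ZMod p) (n := n) hd hdn
  refine ⟨d, r, c, hr, fun Y => ?_⟩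
  calc _ = ∑ u, c u • pullback (u * Y) x := by
        rw [map_sum]
        refine Finset.sum_congr rfl fun u _ => ?_
        rw [← algebraMap_smul (MvPolynomial (Fin d) (ZMod p)) (c u), MvPolynomial.smul_eval,
          eval_aeval_sum_C_pullback_mul_X, Algebra.smul_def]
    _ = (∑ u, c u * if LinearIndependent (ZMod p) (u * Y).row then 1 else 0) • r := by
        simp only [pullback_eq, Finset.sum_smul, mul_smul, ite_smul, one_smul, zero_smul]
    _ = if Y.det = 0 then 0 else r := by
        simp only [hc, ite_smul, one_smul, zero_smul, Matrix.linearIndependent_rows_iff_isUnit,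
          Matrix.isUnit_iff_isUnit_det, isUnit_iff_ne_zero, ne_eq, ite_not]

theorem exists_det_pow_mem_span (hx : x ∈ augmentation p n) (hx0 : x ≠ 0) {m : ℕ}
    (hm : x.IsHomogeneous m) :
    ∃ K : ℕ, ∀ E : Fin n → ℕ, (∀ l, K ≤ E l) →
      (Matrix.of fun l i => (MvPolynomial.X i ^ p ^ E l : MvPolynomial (Fin n) (ZMod p))).det ^
        (p - 1) ∈ Submodule.span (SteenrodAlgebra p) {x} := by
  obtain ⟨d, r, c, hr, eval_eq⟩ := exists_eval_eq_ite_det hx hx0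
  let A := MvPolynomial (Fin d) (ZMod p)
  have : CharP (MvPolynomial (Fin n) A) p :=
    charP_of_injective_algebraMap (algebraMap (ZMod p) (MvPolynomial (Fin n) A)).injective p
  obtain ⟨K, hK⟩ := exists_coeff_aeval_traceSum_eq_det_pow eval_eq
    (MvPolynomial.X : Fin n → MvPolynomial (Fin n) A)
  refine ⟨K, fun E hE => ?_⟩
  have map_det : (Matrix.of fun l i =>
      (MvPolynomial.X i ^ p ^ E l : MvPolynomial (Fin n) (ZMod p))).det.map
        (algebraMap (ZMod p) A) =
        (Matrix.of fun l i => (MvPolynomial.X i ^ p ^ E l : MvPolynomial (Fin n) A)).det := by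
    rw [RingHom.map_det]
    congr 1
    ext1 l i
    simp
  refine mem_of_smul_map_algebraMap_mem_scalarExtension
    (N := (Submodule.span (SteenrodAlgebra p) {x}).restrictScalars (ZMod p)) hr ?_
  rw [map_pow, map_det, ← hK E hE, map_sum, MvPolynomial.coeff_sum]
  refine Submodule.sum_mem _ fun u _ => ?_
  rw [← AlgHom.restrictScalars_apply (ZMod p), map_smul, AlgHom.restrictScalars_apply,
    aeval_aeval_sum_C_mul_X, ← algebraMap_smul A (c u), MvPolynomial.coeff_smul]
  exact Submodule.smul_mem _ _ (coeff_aeval_sum_traceSum_mem_scalarExtension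
    (Submodule.mem_span_singleton_self x) hm _ E _)

end MooreDeterminant

section LowDegree

open scoped Matrix

section Pullback

variable {k : Type*} [CommSemiring k] {m n : Type*} [Fintype m]

theorem eval_pullback (M : Matrix m n k) (a : m → k) (x : MvPolynomial n k) :
    MvPolynomial.eval a (pullback M x) = MvPolynomial.eval (a ᵥ* M) x := by
  induction x using MvPolynomial.induction_on with
  | C c => simp [pullback]
  | add f g hf hg => simp only [map_add, hf, hg]
  | mul_X f j hf =>
    simp [hf, Matrix.vecMul, dotProduct, MvPolynomial.smul_eval, mul_comm (M _ j)]

theorem pderiv_pullback [Fintype n] (M : Matrix m n k) (i : m) (x : MvPolynomial n k) :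
    MvPolynomial.pderiv i (pullback M x) =
      ∑ j, M i j • pullback M (MvPolynomial.pderiv j x) := by
  classical
  induction x using MvPolynomial.induction_on with
  | C c => simp [pullback]
  | add f g hf hg => simp only [map_add, hf, hg, smul_add, Finset.sum_add_distrib]
  | mul_X f l hf =>
    simp only [map_mul, map_add, map_sum, Derivation.leibniz, pullback_X, hf,
      MvPolynomial.pderiv_X, smul_eq_mul, smul_add, Finset.sum_add_distrib, Finset.mul_sum]
    congr 1
    · simp [Pi.single_apply, apply_ite (pullback M), smul_ite]
    · simp only [Finset.sum_mul, Finset.smul_sum, mul_smul_comm, smul_mul_assoc, smul_smul]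
      rw [Finset.sum_comm]

theorem finSuccEquiv_pullback_updateCol {d : ℕ} (w : Fin (d + 1) → k)
    (x : MvPolynomial (Fin (d + 1)) k) :
    MvPolynomial.finSuccEquiv k d (pullback ((1 : Matrix _ _ k).updateCol 0 w) x) =
      (MvPolynomial.finSuccEquiv k d x).comp
        (C (MvPolynomial.C (w 0)) * X + C (∑ i : Fin d, w i.succ • MvPolynomial.X i)) := by
  induction x using MvPolynomial.induction_on with
  | C c => simp [pullback, MvPolynomial.finSuccEquiv_apply]
  | add f g hf hg => simp only [map_add, hf, hg, add_comp]
  | mul_X f j hf =>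
    rw [map_mul, map_mul, map_mul, hf, mul_comp]
    refine congrArg _ ?_
    cases j using Fin.cases with
    | zero => simp [Fin.sum_univ_succ, MvPolynomial.finSuccEquiv_apply,
        MvPolynomial.smul_eq_C_mul]
    | succ j => simp [MvPolynomial.finSuccEquiv_X_succ, Matrix.one_apply]

theorem coeff_zero_finSuccEquiv {d : ℕ} (x : MvPolynomial (Fin (d + 1)) k) :
    (MvPolynomial.finSuccEquiv k d x).coeff 0 =
      pullback ((1 : Matrix (Fin (d + 1)) _ k).submatrix Fin.succ id) x := by
  induction x using MvPolynomial.induction_on with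
  | C c => simp [pullback, MvPolynomial.finSuccEquiv_apply]
  | add f g hf hg => simp only [map_add, coeff_add, hf, hg]
  | mul_X f j hf =>
    rw [map_mul, map_mul, mul_coeff_zero, hf, pullback_X]
    congr 1
    cases j using Fin.cases with
    | zero => simp [MvPolynomial.finSuccEquiv_X_zero]
    | succ j => simp [MvPolynomial.finSuccEquiv_X_succ, Matrix.one_apply]

end Pullback

theorem sum_rootMultiplicity_le_natDegree {R : Type*} [CommRing R] [IsDomain R] (P : R[X])
    (s : Finset R) : ∑ a ∈ s, P.rootMultiplicity a ≤ P.natDegree := by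
  classical
  calc ∑ a ∈ s, P.rootMultiplicity a ≤ ∑ a ∈ s ∪ P.roots.toFinset, P.roots.count a := by
        simp only [← count_roots]
        exact Finset.sum_le_sum_of_subset Finset.subset_union_left
    _ = P.roots.card := Multiset.sum_count_eq_card fun a ha =>
      Finset.mem_union_right _ (Multiset.mem_toFinset.2 ha)
    _ ≤ P.natDegree := card_roots' P

theorem card_mul_natTrailingDegree_le_natDegree {R : Type*} [CommRing R] [IsDomain R] {P : R[X]}
    {s : Finset R} (hP : ∀ a ∈ s, P.comp (X + C a) = P) :
    s.card * P.natTrailingDegree ≤ P.natDegree :=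
  calc s.card * P.natTrailingDegree = ∑ a ∈ s, P.rootMultiplicity a := by
        rw [Finset.sum_congr rfl fun a ha => ?_, Finset.sum_const, smul_eq_mul]
        rw [rootMultiplicity_eq_natTrailingDegree, hP a ha]
    _ ≤ P.natDegree := sum_rootMultiplicity_le_natDegree P s

theorem card_sub_one_dvd_of_coeff_ne_zero {K R : Type*} [Field K] [Fintype K] [CommRing R]
    [IsDomain R] [Algebra K R] {P : R[X]}
    (hP : ∀ c : Kˣ, P.comp (C (algebraMap K R c) * X) = P) {i : ℕ} (hi : P.coeff i ≠ 0) :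
    Fintype.card K - 1 ∣ i := by
  refine (FiniteField.forall_pow_eq_one_iff K i).1 fun c => Units.ext ?_
  have coeff_mul := congrArg (coeff · i) (hP c)
  simp only [comp_C_mul_X_coeff, ← map_pow] at coeff_mul
  refine (algebraMap K R).injective ?_
  rw [Units.val_pow_eq_pow_val, mul_left_cancel₀ hi (coeff_mul.trans (mul_one _).symm),
    Units.val_one, map_one]

theorem eval_single_one_of_isHomogeneous {R σ : Type*} [CommSemiring R] [Finite σ]
    [DecidableEq σ] {x : MvPolynomial σ R} {m : ℕ} (hx : x.IsHomogeneous m) (i : σ) :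
    MvPolynomial.eval (Pi.single i 1) x = MvPolynomial.coeff (Finsupp.single i m) x := by
  have := Fintype.ofFinite σ
  rw [MvPolynomial.eval_eq', Finset.sum_eq_single (Finsupp.single i m)]
  · rw [Finset.prod_eq_one, mul_one]
    intro j _
    rcases eq_or_ne j i with rfl | hj
    · rw [Pi.single_eq_same, one_pow]
    · rw [Finsupp.single_eq_of_ne hj, pow_zero]
  · intro s hs hne
    have exists_ne : ∃ j, j ≠ i ∧ s j ≠ 0 := by
      by_contra! hs0
      have s_eq : s = Finsupp.single i (s i) := Finsupp.ext fun j => by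
        rcases eq_or_ne j i with rfl | hj
        · rw [Finsupp.single_eq_same]
        · rw [hs0 j hj, Finsupp.single_eq_of_ne hj]
      have weight_s := hx (MvPolynomial.mem_support_iff.1 hs)
      rw [s_eq, Finsupp.weight_single, Pi.one_apply, smul_eq_mul, mul_one] at weight_s
      exact hne (weight_s ▸ s_eq)
    obtain ⟨j, hj, hsj⟩ := exists_ne
    rw [Finset.prod_eq_zero (Finset.mem_univ j), mul_zero]
    rw [Pi.single_eq_of_ne hj, zero_pow hsj]
  · intro hs
    rw [MvPolynomial.notMem_support_iff.1 hs, zero_mul]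

theorem degreeOf_lt_of_eval_single_eq_zero {R σ : Type*} [CommSemiring R] [Finite σ]
    [DecidableEq σ] {x : MvPolynomial σ R} {m : ℕ} (hx : x.IsHomogeneous m) (hm : 0 < m) {i : σ}
    (h : MvPolynomial.eval (Pi.single i 1) x = 0) : x.degreeOf i < m := by
  rw [MvPolynomial.degreeOf_lt_iff hm]
  intro s hs
  have degree_s : s.degree = m := by
    rw [Finsupp.degree_eq_weight_one]
    exact hx (MvPolynomial.mem_support_iff.1 hs)
  refine lt_of_le_of_ne (degree_s ▸ Finsupp.le_degree i s) fun hsi => ?_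
  have erase_s : s.erase i = 0 := by
    rw [← Finsupp.degree_eq_zero_iff]
    have := congrArg Finsupp.degree (Finsupp.single_add_erase i s)
    rw [map_add, Finsupp.degree_single, degree_s, hsi] at this
    exact Nat.add_eq_left.1 this
  have s_eq : s = Finsupp.single i m := by
    rw [← Finsupp.single_add_erase i s, erase_s, add_zero, hsi]
  rw [eval_single_one_of_isHomogeneous hx, ← s_eq] at h
  exact MvPolynomial.mem_support_iff.1 hs h

section FrobeniusPower

variable {p : ℕ} [Fact p.Prime] {σ : Type*}

theorem exists_pow_eq_of_pderiv_eq_zero {x : MvPolynomial σ (ZMod p)}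
    (hx : ∀ i, MvPolynomial.pderiv i x = 0) : ∃ w, w ^ p = x := by
  have dvd_of_mem_support {s : σ →₀ ℕ} (hs : s ∈ x.support) (i : σ) : p ∣ s i := by
    by_cases hsi : s i = 0
    · exact hsi ▸ dvd_zero p
    have sub_add : s - Finsupp.single i 1 + Finsupp.single i 1 = s :=
      tsub_add_cancel_of_le (Finsupp.single_le_iff.2 (Nat.one_le_iff_ne_zero.2 hsi))
    have coeff_mul : MvPolynomial.coeff s x * (s i : ZMod p) = 0 := by
      have := MvPolynomial.coeff_pderiv x (s - Finsupp.single i 1) (i := i)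
      rw [hx, MvPolynomial.coeff_zero, sub_add, Finsupp.tsub_apply, Finsupp.single_eq_same] at this
      rw [this]
      norm_cast
      rw [Nat.sub_add_cancel (Nat.one_le_iff_ne_zero.2 hsi)]
    exact (CharP.cast_eq_zero_iff (ZMod p) p _).1
      ((mul_eq_zero.1 coeff_mul).resolve_left (MvPolynomial.mem_support_iff.1 hs))
  suffices x ∈ (MvPolynomial.expand p (R := ZMod p) (σ := σ)).range by
    obtain ⟨w, rfl⟩ := this
    exact ⟨w, (MvPolynomial.expand_zmod w).symm⟩
  rw [x.as_sum]
  refine Subalgebra.sum_mem _ fun s hs => ⟨MvPolynomial.monomial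
    (s.mapRange (· / p) (Nat.zero_div p)) (MvPolynomial.coeff s x), ?_⟩
  have smul_div : p • s.mapRange (· / p) (Nat.zero_div p) = s :=
    Finsupp.ext fun i => Nat.mul_div_cancel' (dvd_of_mem_support hs i)
  exact (MvPolynomial.expand_monomial _ _ _).trans (by rw [smul_div])

theorem isHomogeneous_of_pow {w : MvPolynomial σ (ZMod p)} {m : ℕ}
    (h : (w ^ p).IsHomogeneous m) : w.IsHomogeneous (m / p) := by
  have hp : p.Prime := Fact.out
  intro s hs
  rw [← MvPolynomial.expand_zmod] at h
  have weight_smul := h (d := p • s) (by rwa [MvPolynomial.coeff_expand_smul _ hp.ne_zero])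
  rw [map_nsmul, smul_eq_mul] at weight_smul
  rw [← weight_smul, Nat.mul_div_cancel_left _ hp.pos]

theorem mem_invariants_of_pow_mem {n : ℕ} {w : MvPolynomial (Fin n) (ZMod p)}
    (h : w ^ p ∈ invariants p n) : w ∈ invariants p n :=
  mem_invariants.2 fun g => frobenius_inj (MvPolynomial (Fin n) (ZMod p)) p <|
    (map_pow (subst p n g) w p).symm.trans (mem_invariants.1 h g)

end FrobeniusPower

section Invariants

variable {p : ℕ} [Fact p.Prime] {n : ℕ}

theorem pullback_eq_self_of_det_ne_zero {x : MvPolynomial (Fin n) (ZMod p)}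
    (hx : x ∈ invariants p n) {M : Matrix (Fin n) (Fin n) (ZMod p)} (hM : M.det ≠ 0) :
    pullback M x = x :=
  mem_invariants.1 hx (Matrix.GeneralLinearGroup.mkOfDetNeZero M hM)

theorem eval_eq_eval_of_ne_zero {x : MvPolynomial (Fin n) (ZMod p)} (hx : x ∈ invariants p n)
    {a b : Fin n → ZMod p} (ha : a ≠ 0) (hb : b ≠ 0) :
    MvPolynomial.eval a x = MvPolynomial.eval b x := by
  have linearIndependent {a : Fin n → ZMod p} (ha : a ≠ 0) :
      LinearIndependent (ZMod p) (Matrix.of fun _ : Unit => a).row :=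
    LinearIndependent.of_subsingleton () ha
  have eval_eq (a : Fin n → ZMod p) : MvPolynomial.eval a x =
      MvPolynomial.eval 1 (pullback (Matrix.of fun _ : Unit => a) x) := by
    rw [eval_pullback]
    congr 2
    ext i
    simp [Matrix.vecMul, dotProduct]
  rw [eval_eq, eval_eq, pullback_eq_pullback_of_linearIndependent_row hx (linearIndependent ha)
    (linearIndependent hb)]

theorem pderiv_pullback_eq_zero {m : Type*} [Fintype m] {x : MvPolynomial (Fin n) (ZMod p)}
    (hx : x ∈ invariants p n) {M : Matrix m (Fin n) (ZMod p)} {j : Fin n} (hM : ∀ i, M i j = 0)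
    (i : m) : MvPolynomial.pderiv i (pullback M x) = 0 := by
  -- Differentiate the invariance of `x` under the transvection `X l ↦ X l + X j`, then apply
  -- `pullback M`.
  have pullback_pderiv {l : Fin n} (hl : l ≠ j) : pullback M (MvPolynomial.pderiv l x) = 0 := by
    let g := (1 : Matrix (Fin n) (Fin n) (ZMod p)).updateRow j (Pi.single j 1 + Pi.single l 1)
    have mul_g : M * g = M := by
      ext i c
      rw [Matrix.mul_apply]
      calc ∑ b, M i b * g b c = ∑ b, M i b * (1 : Matrix (Fin n) (Fin n) (ZMod p)) b c := by
            refine Finset.sum_congr rfl fun b _ => ?_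
            rcases eq_or_ne b j with rfl | hb
            · rw [hM, zero_mul, zero_mul]
            · simp only [g, Matrix.updateRow_ne hb]
        _ = M i c := by rw [← Matrix.mul_apply, Matrix.mul_one]
    have det_g : g.det ≠ 0 := by
      rw [← Matrix.cramer_transpose_apply, Matrix.transpose_one, Matrix.cramer_one]
      simp [hl]
    have := congrArg (pullback M) (pderiv_pullback g j x)
    rw [pullback_eq_self_of_det_ne_zero hx det_g] at this
    simp only [map_sum, map_smul, ← AlgHom.comp_apply, ← pullback_mul, mul_g] at this
    simpa [g, add_smul, Finset.sum_add_distrib, Pi.single_apply, ite_smul] using this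
  rw [pderiv_pullback]
  refine Finset.sum_eq_zero fun l _ => ?_
  rcases eq_or_ne l j with rfl | hl
  · rw [hM, zero_smul]
  · rw [pullback_pderiv hl, smul_zero]

theorem finSuccEquiv_comp_eq_self {x : MvPolynomial (Fin (n + 1)) (ZMod p)}
    (hx : x ∈ invariants p (n + 1)) {w : Fin (n + 1) → ZMod p} (hw : w 0 ≠ 0) :
    (MvPolynomial.finSuccEquiv (ZMod p) n x).comp
        (C (MvPolynomial.C (w 0)) * X + C (∑ i : Fin n, w i.succ • MvPolynomial.X i)) =
      MvPolynomial.finSuccEquiv (ZMod p) n x := by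
  rw [← finSuccEquiv_pullback_updateCol, pullback_eq_self_of_det_ne_zero hx]
  rwa [← Matrix.cramer_apply, Matrix.cramer_one]

theorem exists_pow_eq_coeff_zero_finSuccEquiv {x : MvPolynomial (Fin (n + 1)) (ZMod p)}
    (hx : x ∈ invariants p (n + 1)) :
    ∃ w ∈ invariants p n, w ^ p = (MvPolynomial.finSuccEquiv (ZMod p) n x).coeff 0 := by
  let S := (1 : Matrix (Fin (n + 1)) (Fin (n + 1)) (ZMod p)).submatrix Fin.succ id
  have linearIndependent_S : LinearIndependent (ZMod p) S.row :=
    (Matrix.linearIndependent_rows_of_isUnit isUnit_one).comp _ (Fin.succ_injective n)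
  obtain ⟨w, hw⟩ := exists_pow_eq_of_pderiv_eq_zero
    (pderiv_pullback_eq_zero hx (M := S) (j := 0) fun i => by simp [S])
  rw [coeff_zero_finSuccEquiv]
  refine ⟨w, mem_invariants_of_pow_mem (mem_invariants.2 fun g => ?_), hw⟩
  have linearIndependent_mul :
      LinearIndependent (ZMod p) ((g : Matrix (Fin n) (Fin n) (ZMod p)) * S).row := by
    rw [← Matrix.vecMul_injective_iff] at linearIndependent_S ⊢
    simpa only [Function.comp_def, Matrix.vecMul_vecMul] using
      linearIndependent_S.comp (Matrix.vecMul_injective_of_isUnit g.isUnit)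
  rw [hw]
  change pullback (g : Matrix (Fin n) (Fin n) (ZMod p)) _ = _
  rw [← AlgHom.comp_apply, ← pullback_mul]
  exact pullback_eq_pullback_of_linearIndependent_row hx linearIndependent_mul linearIndependent_S

theorem pow_mul_le_natDegree_finSuccEquiv {x : MvPolynomial (Fin (n + 1)) (ZMod p)}
    (hx : x ∈ invariants p (n + 1)) (hx0 : x ≠ 0)
    (h0 : (MvPolynomial.finSuccEquiv (ZMod p) n x).coeff 0 = 0) :
    p ^ n * (p - 1) ≤ (MvPolynomial.finSuccEquiv (ZMod p) n x).natDegree := by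
  set P := MvPolynomial.finSuccEquiv (ZMod p) n x with hP
  have P_ne_zero : P ≠ 0 := by rwa [hP, Ne, EmbeddingLike.map_eq_zero_iff]
  let linearForms : Finset (MvPolynomial (Fin n) (ZMod p)) := Finset.univ.map
    ⟨Fintype.linearCombination (ZMod p) MvPolynomial.X,
      (MvPolynomial.linearIndependent_X (Fin n) (ZMod p)).fintypeLinearCombination_injective⟩
  have card_linearForms : linearForms.card = p ^ n := by
    simp [linearForms, ZMod.card]
  have comp_eq_self : ∀ ℓ ∈ linearForms, P.comp (X + C ℓ) = P := by
    intro ℓ hℓ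
    obtain ⟨v, -, rfl⟩ := Finset.mem_map.1 hℓ
    simpa [Fintype.linearCombination_apply] using
      finSuccEquiv_comp_eq_self hx (w := Fin.cons 1 v) one_ne_zero
  have comp_mul_eq_self (c : (ZMod p)ˣ) :
      P.comp (C (algebraMap (ZMod p) (MvPolynomial (Fin n) (ZMod p)) c) * X) = P := by
    simpa using finSuccEquiv_comp_eq_self hx (w := Fin.cons (c : ZMod p) 0) c.ne_zero
  have sub_one_dvd : p - 1 ∣ P.natTrailingDegree := by
    simpa only [ZMod.card] using card_sub_one_dvd_of_coeff_ne_zero comp_mul_eq_self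
      (coeff_natTrailingDegree_ne_zero.2 P_ne_zero)
  calc p ^ n * (p - 1) ≤ linearForms.card * P.natTrailingDegree := by
        rw [card_linearForms]
        exact Nat.mul_le_mul_left _ (Nat.le_of_dvd (Nat.pos_of_ne_zero
          (natTrailingDegree_ne_zero.2 ⟨P_ne_zero, h0⟩)) sub_one_dvd)
    _ ≤ P.natDegree := card_mul_natTrailingDegree_le_natDegree comp_eq_self

/-- The bound says `m ≤ p ^ n - p ^ (n - 1)`, which is the degree of `d_{n,1}`. -/
theorem eq_zero_of_forall_eval_eq_zero {x : MvPolynomial (Fin n) (ZMod p)} (hx : x ∈ invariants p n)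
    {m : ℕ} (hm : x.IsHomogeneous m) (hle : p * m ≤ p ^ n * (p - 1))
    (h : ∀ a, MvPolynomial.eval a x = 0) : x = 0 := by
  have hp : p.Prime := Fact.out
  induction n generalizing m with
  | zero =>
    rw [MvPolynomial.eq_C_of_isEmpty x] at h ⊢
    simpa only [MvPolynomial.eval_C, map_eq_zero] using h 0
  | succ n ih =>
    have coeff_zero : (MvPolynomial.finSuccEquiv (ZMod p) n x).coeff 0 = 0 := by
      obtain ⟨w, hw, pow_eq⟩ := exists_pow_eq_coeff_zero_finSuccEquiv hx
      have homogeneous := hm.finSuccEquiv_coeff_isHomogeneous 0 m (zero_add m)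
      rw [← pow_eq] at homogeneous ⊢
      have le_w : p * (m / p) ≤ p ^ n * (p - 1) := by
        refine (Nat.mul_div_le m p).trans (Nat.le_of_mul_le_mul_left ?_ hp.pos)
        rwa [← mul_assoc, ← pow_succ']
      have eval_w (a : Fin n → ZMod p) : MvPolynomial.eval a w = 0 := by
        rw [← pow_eq_zero_iff hp.ne_zero, ← map_pow, pow_eq, coeff_zero_finSuccEquiv,
          eval_pullback, h]
      rw [ih hw (isHomogeneous_of_pow homogeneous) le_w eval_w, zero_pow hp.ne_zero]
    by_contra hx0
    have le_degreeOf := pow_mul_le_natDegree_finSuccEquiv hx hx0 coeff_zero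
    rw [MvPolynomial.natDegree_finSuccEquiv] at le_degreeOf
    have m_le : m ≤ p ^ n * (p - 1) := Nat.le_of_mul_le_mul_left
      (by rwa [← mul_assoc, ← pow_succ']) hp.pos
    have m_pos : 0 < m := (Nat.mul_pos (pow_pos hp.pos n) (Nat.sub_pos_of_lt hp.one_lt)).trans_le
      (le_degreeOf.trans ((MvPolynomial.degreeOf_le_totalDegree x 0).trans hm.totalDegree_le))
    exact (degreeOf_lt_of_eval_single_eq_zero hm m_pos (h _)).not_ge (m_le.trans le_degreeOf)

end Invariants
end LowDegree

section GradedEndomorphism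

variable {k A M : Type*} [CommRing k] [Ring A] [AddCommGroup M] [Module k M] [Module A M]

theorem bijOn_iSup {ι F : Type*} [FunLike F M M] [AddMonoidHomClass F M M]
    {𝓜 : ι → Submodule k M} (h𝓜 : iSupIndep 𝓜) {f : F}
    (hf : ∀ i, Set.BijOn f (𝓜 i) (𝓜 i)) :
    Set.BijOn f (⨆ i, 𝓜 i : Submodule k M) (⨆ i, 𝓜 i : Submodule k M) := by
  refine ⟨fun x hx => ?_, fun x hx y hy hxy => ?_, fun y hy => ?_⟩
  · refine Submodule.iSup_induction 𝓜 (motive := fun x => f x ∈ ⨆ i, 𝓜 i) hx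
      (fun i x hx => Submodule.mem_iSup_of_mem i ((hf i).mapsTo hx)) ?_ fun x y hx hy => ?_
    · rw [map_zero]
      exact zero_mem _
    · rw [map_add]
      exact add_mem hx hy
  · obtain ⟨z, hz, hsum⟩ := (Submodule.mem_iSup_iff_exists_finsupp 𝓜 (x - y)).1 (sub_mem hx hy)
    have map_sum_eq_zero : ∑ i ∈ z.support, f (z i) = 0 := by
      rw [← map_sum]
      exact (congrArg f hsum).trans (by rw [map_sub, hxy, sub_self])
    have map_eq_zero := (iSupIndep_iff_finsetSum_eq_zero_imp_eq_zero 𝓜).1 h𝓜 _ _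
      (fun i _ => (hf i).mapsTo (hz i)) map_sum_eq_zero
    rw [← sub_eq_zero, ← hsum]
    exact Finset.sum_eq_zero fun i hi =>
      (hf i).injOn (hz i) (zero_mem _) ((map_eq_zero i hi).trans (map_zero f).symm)
  · refine Submodule.iSup_induction 𝓜 (motive := fun y => y ∈ f '' (⨆ i, 𝓜 i : Submodule k M)) hy
      (fun i y hy => ?_) ⟨0, zero_mem _, map_zero f⟩ ?_
    · obtain ⟨x, hx, rfl⟩ := (hf i).surjOn hy
      exact ⟨x, Submodule.mem_iSup_of_mem i hx, rfl⟩
    · rintro _ _ ⟨x, hx, rfl⟩ ⟨y, hy, rfl⟩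
      exact ⟨x + y, add_mem hx hy, map_add f x y⟩

theorem IsDegreeZero.bijOn {𝓜 : ℕ → Submodule k M} {f : M →ₗ[A] M} (hf : IsDegreeZero 𝓜 f)
    {i : ℕ} (hfin : (𝓜 i : Set M).Finite) (hker : ∀ x ∈ 𝓜 i, f x = 0 → x = 0) :
    Set.BijOn f (𝓜 i) (𝓜 i) := by
  refine (Set.Finite.injOn_iff_bijOn_of_mapsTo hfin (hf i)).1 fun x hx y hy hxy => ?_
  exact sub_eq_zero.1 (hker _ (sub_mem hx hy) (by rw [map_sub, hxy, sub_self]))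

theorem isAtomic_of_forall_bijective {𝓜 : ℕ → Submodule k M}
    (h : ∀ f : M →ₗ[A] M, IsDegreeZero 𝓜 f → ∀ i, ∀ w ∈ 𝓜 i, (∀ j, f^[j] w ≠ 0) →
      Function.Bijective f) : IsAtomic A 𝓜 := by
  intro f hf r hr hbij
  obtain ⟨w, hw, hw0⟩ := (Submodule.ne_bot_iff _).1 hr.1.2
  exact h f hf r w hw fun j hj => hw0 ((hbij.iterate j).injOn hw (zero_mem _)
    (hj.trans (Function.iterate_fixed (map_zero f) j).symm))

theorem IsDegreeZero.bijOn_biSup {𝓜 : ℕ → Submodule k M} {f : M →ₗ[A] M}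
    (hf : IsDegreeZero 𝓜 f) (h𝓜 : iSupIndep 𝓜) (hfin : ∀ i, (𝓜 i : Set M).Finite) {I : Set ℕ}
    (hker : ∀ i ∈ I, ∀ x ∈ 𝓜 i, f x = 0 → x = 0) :
    Set.BijOn f (⨆ i ∈ I, 𝓜 i : Submodule k M) (⨆ i ∈ I, 𝓜 i : Submodule k M) := by
  rw [iSup_subtype']
  exact bijOn_iSup (h𝓜.comp Subtype.val_injective) fun i => hf.bijOn (hfin i) (hker i i.2)

theorem exists_iterate_mem_periodicPts {α : Type*} {f : α → α} {s : Set α} (hs : s.Finite)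
    (hf : Set.MapsTo f s s) {x : α} (hx : x ∈ s) : ∃ k, f^[k] x ∈ Function.periodicPts f := by
  obtain ⟨k, l, hkl, h⟩ := hs.exists_lt_map_eq_of_forall_mem (f := fun k => f^[k] x)
    fun k => hf.iterate k hx
  refine ⟨k, Function.mk_mem_periodicPts (Nat.sub_pos_of_lt hkl) ?_⟩
  rw [Function.IsPeriodicPt, Function.IsFixedPt, ← Function.iterate_add_apply,
    Nat.sub_add_cancel hkl.le]
  exact h.symm

theorem apply_ne_zero_of_smul_eq_smul {f : M →ₗ[A] M} {x u : M}
    (hu : u ∈ Function.periodicPts f) {a b : A} (h : a • x = b • u) (h0 : a • x ≠ 0) :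
    f x ≠ 0 := by
  intro hfx
  obtain ⟨m, m_pos, hm⟩ := hu
  have smul_mem : b • u ∈ Function.periodicPts f :=
    ⟨m, m_pos, hm.map fun v => (map_smul f b v).symm⟩
  have zero_mem : (0 : M) ∈ Function.periodicPts f := ⟨1, one_pos, map_zero f⟩
  refine h0 (h.trans ((Function.bijOn_periodicPts f).injOn smul_mem zero_mem ?_))
  rw [← h, map_smul, hfx, smul_zero, map_zero]

end GradedEndomorphism

section Grading

variable {p : ℕ} [Fact p.Prime] {n : ℕ}
  {N : Submodule (SteenrodAlgebra p) (MvPolynomial (Fin n) (ZMod p))}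

theorem genDegree_pos (p : ℕ) : 0 < genDegree p := by
  unfold genDegree
  split_ifs <;> omega

omit [Fact p.Prime] in
theorem weight_genDegree (d : Fin n →₀ ℕ) :
    Finsupp.weight (fun _ => genDegree p) d = genDegree p * Finsupp.weight 1 d := by
  simp [Finsupp.weight_apply, Finsupp.sum, Finset.mul_sum, mul_comm]

theorem mem_component_iff {x : N} {m : ℕ} : x ∈ component p n N (genDegree p * m) ↔
    (x : MvPolynomial (Fin n) (ZMod p)).IsHomogeneous m := by
  change (∀ ⦃d⦄, _ → Finsupp.weight _ d = _) ↔ (∀ ⦃d⦄, _ → Finsupp.weight 1 d = m)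
  simp only [weight_genDegree, Nat.mul_right_inj (genDegree_pos p).ne']
  rfl

theorem isHomogeneous_of_mem_component {x : N} {i : ℕ} (hx : x ∈ component p n N i) :
    (x : MvPolynomial (Fin n) (ZMod p)).IsHomogeneous (i / genDegree p) := fun d hd => by
  have h : Finsupp.weight _ d = i := hx hd
  rw [← h, weight_genDegree, Nat.mul_div_cancel_left _ (genDegree_pos p)]

theorem iSupIndep_component : iSupIndep (component p n N) := by
  let := MvPolynomial.weightedGradedAlgebra (ZMod p) fun _ : Fin n => genDegree p
  have h := (DirectSum.Decomposition.isInternal (MvPolynomial.weightedHomogeneousSubmodule (ZMod p)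
    fun _ : Fin n => genDegree p)).submodule_iSupIndep
  rw [iSupIndep_iff_finsetSum_eq_zero_imp_eq_zero] at h ⊢
  intro s x hx hsum i hi
  refine Subtype.ext (h s (fun i => x i) hx ?_ i hi)
  rw [← Submodule.coe_sum, hsum]
  rfl

theorem finite_component (i : ℕ) : (component p n N i : Set N).Finite := by
  let W := MvPolynomial.weightedHomogeneousSubmodule (ZMod p) (fun _ : Fin n => genDegree p) i
  have : Module.Finite (ZMod p) W := Module.Finite.iff_fg.2
    (MvPolynomial.weightedHomogeneousSubmodule_fg (R := ZMod p) _
      (fun _ => (genDegree_pos p).ne') i)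
  have : Finite W := Module.finite_of_finite (ZMod p)
  have finite_preimage : ((↑) ⁻¹' (W : Set (MvPolynomial (Fin n) (ZMod p))) : Set N).Finite :=
    (Set.toFinite _).preimage Subtype.val_injective.injOn
  exact finite_preimage

theorem mem_biSup_component (hN : ∀ x ∈ N, ∀ m, MvPolynomial.homogeneousComponent m x ∈ N)
    {I : Set ℕ} {x : N}
    (hx : ∀ m, MvPolynomial.homogeneousComponent m (x : MvPolynomial (Fin n) (ZMod p)) ≠ 0 →
      genDegree p * m ∈ I) : x ∈ ⨆ i ∈ I, component p n N i := by
  have sum_eq : x = ∑ m ∈ Finset.range ((x : MvPolynomial (Fin n) (ZMod p)).totalDegree + 1),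
      (⟨MvPolynomial.homogeneousComponent m x, hN x x.2 m⟩ : N) := by
    apply Subtype.ext
    rw [Submodule.coe_sum]
    exact (MvPolynomial.sum_homogeneousComponent _).symm
  rw [sum_eq]
  refine sum_mem fun m _ => ?_
  by_cases h0 : MvPolynomial.homogeneousComponent m (x : MvPolynomial (Fin n) (ZMod p)) = 0
  · simp only [h0]
    exact zero_mem _
  · exact Submodule.mem_iSup_of_mem _ (Submodule.mem_iSup_of_mem (hx m h0)
      (mem_component_iff.2 (MvPolynomial.homogeneousComponent_isHomogeneous m _)))

end Grading

section HomogeneousInvariants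

theorem coeff_prod_X_sub_C_isHomogeneous {σ ι R : Type*} [CommRing R] {ℓ : ι → MvPolynomial σ R}
    (hℓ : ∀ v, (ℓ v).IsHomogeneous 1) {s : Finset ι} {k : ℕ} (hk : k ≤ s.card) :
    ((∏ v ∈ s, (X - C (ℓ v))).coeff k).IsHomogeneous (s.card - k) := by
  have coeff_eq : (∏ v ∈ s, (X - C (ℓ v))).coeff k = MvPolynomial.C ((-1) ^ (s.card - k)) *
      ∑ t ∈ s.powersetCard (s.card - k), ∏ v ∈ t, ℓ v := by
    have h := Multiset.prod_X_sub_C_coeff (s.1.map ℓ) (k := k) (by simpa using hk)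
    rw [Multiset.map_map, Multiset.card_map, Finset.card_val, Finset.esymm_map_val] at h
    simpa using h
  rw [coeff_eq]
  refine .C_mul (.sum _ _ _ fun t ht => ?_) _
  have h_prod := MvPolynomial.IsHomogeneous.prod t ℓ (fun _ => 1) fun v _ => hℓ v
  rwa [Finset.sum_const, smul_eq_mul, mul_one, (Finset.mem_powersetCard.1 ht).2] at h_prod

theorem linearForm_isHomogeneous {σ R : Type*} [Fintype σ] [CommSemiring R] (v : σ → R) :
    (∑ i, v i • MvPolynomial.X (R := R) i).IsHomogeneous 1 :=
  .sum _ _ _ fun i _ => by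
    rw [MvPolynomial.smul_eq_C_mul]
    exact (MvPolynomial.isHomogeneous_X _ i).C_mul _

variable {p : ℕ} [Fact p.Prime] {n : ℕ}

theorem dicksonInvariant_isHomogeneous (i : ℕ) :
    (dicksonInvariant p n i).IsHomogeneous (p ^ n - p ^ (n - i)) := by
  have hle : p ^ (n - i) ≤ p ^ n :=
    Nat.pow_le_pow_right (Fact.out : p.Prime).pos (Nat.sub_le n i)
  have card_eq : (Finset.univ : Finset (Fin n → ZMod p)).card = p ^ n := by simp
  have h := coeff_prod_X_sub_C_isHomogeneous (linearForm_isHomogeneous (σ := Fin n) (R := ZMod p))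
    (hle.trans_eq card_eq.symm)
  have neg_one_pow : (-1 : MvPolynomial (Fin n) (ZMod p)) ^ i = MvPolynomial.C ((-1) ^ i) := by
    simp
  rw [dicksonInvariant, neg_one_pow]
  exact (card_eq ▸ h).C_mul _

theorem homogeneousComponent_subst (g : Matrix (Fin n) (Fin n) (ZMod p)) (m : ℕ)
    (x : MvPolynomial (Fin n) (ZMod p)) :
    MvPolynomial.homogeneousComponent m (subst p n g x) =
      subst p n g (MvPolynomial.homogeneousComponent m x) := by
  have hom (k : ℕ) : (subst p n g (MvPolynomial.homogeneousComponent k x)).IsHomogeneous k := by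
    have h := (MvPolynomial.homogeneousComponent_isHomogeneous k x).aeval
      (fun j => ∑ i, g i j • MvPolynomial.X (R := ZMod p) i) fun j => linearForm_isHomogeneous _
    rwa [one_mul] at h
  conv_lhs => rw [← MvPolynomial.sum_homogeneousComponent x, map_sum, map_sum]
  simp only [MvPolynomial.homogeneousComponent_of_mem (hom _)]
  rw [Finset.sum_ite_eq]
  split_ifs with h
  · rfl
  · rw [MvPolynomial.homogeneousComponent_eq_zero _ _ (by simpa [Nat.lt_succ_iff] using h),
      map_zero]

theorem homogeneousComponent_mem_dickson {x : MvPolynomial (Fin n) (ZMod p)}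
    (hx : x ∈ dickson p n) (m : ℕ) : MvPolynomial.homogeneousComponent m x ∈ dickson p n :=
  mem_invariants.2 fun g => by rw [← homogeneousComponent_subst, mem_invariants.1 hx g]

theorem homogeneousComponent_mem_augmentation {x : MvPolynomial (Fin n) (ZMod p)}
    (hx : x ∈ augmentation p n) (m : ℕ) :
    MvPolynomial.homogeneousComponent m x ∈ augmentation p n := by
  refine ⟨homogeneousComponent_mem_dickson hx.1 m, ?_⟩
  rw [MvPolynomial.constantCoeff_eq, MvPolynomial.coeff_homogeneousComponent]
  split_ifs
  · exact hx.2
  · rfl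

variable {N : Submodule (SteenrodAlgebra p) (MvPolynomial (Fin n) (ZMod p))}

theorem mem_augmentation_of_mem_component (hNle : N ≤ dickson p n) {i : ℕ} (hi : i ≠ 0) {x : N}
    (hx : x ∈ component p n N i) : (x : MvPolynomial (Fin n) (ZMod p)) ∈ augmentation p n := by
  refine ⟨hNle x.2, by_contra fun h => hi ?_⟩
  have weight_zero : Finsupp.weight (fun _ : Fin n => genDegree p) 0 = i := hx h
  rw [← weight_zero, map_zero]

theorem coe_biSup_component_compl_zero (hNle : N ≤ dickson p n)
    (hN : ∀ x ∈ N, ∀ m, MvPolynomial.homogeneousComponent m x ∈ N) :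
    ((⨆ i ∈ ({0}ᶜ : Set ℕ), component p n N i : Submodule (ZMod p) N) : Set N) =
      {x : N | (x : MvPolynomial (Fin n) (ZMod p)) ∈ augmentation p n} := by
  refine Set.Subset.antisymm (fun x hx => ?_) fun x hx => mem_biSup_component hN fun m hm => ?_
  · rw [iSup_subtype'] at hx
    refine Submodule.iSup_induction _ (motive := fun x => x.1 ∈ augmentation p n) hx
      (fun i x hx => mem_augmentation_of_mem_component hNle i.2 hx) (zero_mem _)
      fun x y hx hy => add_mem hx hy
  · refine mul_ne_zero (genDegree_pos p).ne' ?_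
    rintro rfl
    rw [MvPolynomial.homogeneousComponent_zero, ← MvPolynomial.constantCoeff_eq, hx.2,
      map_zero] at hm
    exact hm rfl

end HomogeneousInvariants

section Endomorphisms

variable {p : ℕ} [Fact p.Prime] {n : ℕ}

theorem augmentation_le_dickson : augmentation p n ≤ dickson p n := fun _ hx => hx.1

theorem exists_smul_eq_smul {x w : MvPolynomial (Fin n) (ZMod p)} (hx : x ∈ augmentation p n)
    (hx0 : x ≠ 0) {m : ℕ} (hm : x.IsHomogeneous m) (hw : w ∈ augmentation p n)
    (hw0 : w ≠ 0) {m' : ℕ} (hm' : w.IsHomogeneous m') :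
    ∃ a b : SteenrodAlgebra p, a • x = b • w ∧ a • x ≠ 0 := by
  obtain ⟨K, hK⟩ := exists_det_pow_mem_span hx hx0 hm
  obtain ⟨K', hK'⟩ := exists_det_pow_mem_span hw hw0 hm'
  let E : Fin n → ℕ := fun l => max K K' + l
  have E_injective : Function.Injective fun l => p ^ E l :=
    (Nat.pow_right_injective (Fact.out : p.Prime).two_le).comp
      ((add_right_injective _).comp Fin.val_injective)
  obtain ⟨a, ha⟩ := Submodule.mem_span_singleton.1
    (hK E fun l => (le_max_left K K').trans (Nat.le_add_right _ _))
  obtain ⟨b, hb⟩ := Submodule.mem_span_singleton.1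
    (hK' E fun l => (le_max_right K K').trans (Nat.le_add_right _ _))
  refine ⟨a, b, ha.trans hb.symm, ?_⟩
  rw [ha]
  exact pow_ne_zero _ (det_X_pow_ne_zero E_injective)

theorem eq_zero_of_apply_eq_zero
    {N : Submodule (SteenrodAlgebra p) (MvPolynomial (Fin n) (ZMod p))} (hN : N ≤ dickson p n)
    {f : N →ₗ[SteenrodAlgebra p] N} (hf : IsDegreeZero (component p n N) f)
    {i : ℕ} (hi : i ≠ 0) {w : N} (hw : w ∈ component p n N i) (hfw : ∀ k, f^[k] w ≠ 0)
    {j : ℕ} (hj : j ≠ 0) {x : N} (hx : x ∈ component p n N j) (hfx : f x = 0) : x = 0 := by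
  by_contra hx0
  obtain ⟨k, hk⟩ := exists_iterate_mem_periodicPts (finite_component i) (hf i) hw
  have iterate_mem : f^[k] w ∈ component p n N i := Set.MapsTo.iterate (hf i) k hw
  obtain ⟨a, b, hab, h0⟩ := exists_smul_eq_smul
    (mem_augmentation_of_mem_component hN hj hx) (fun h => hx0 (Subtype.ext h))
    (isHomogeneous_of_mem_component hx)
    (mem_augmentation_of_mem_component hN hi iterate_mem) (fun h => hfw k (Subtype.ext h))
    (isHomogeneous_of_mem_component iterate_mem)
  exact apply_ne_zero_of_smul_eq_smul (x := x) hk (a := a) (b := b) (Subtype.ext hab)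
    (fun h => h0 (congrArg Subtype.val h)) hfx

theorem bijOn_augmentation
    {N : Submodule (SteenrodAlgebra p) (MvPolynomial (Fin n) (ZMod p))} (hNle : N ≤ dickson p n)
    (hN : ∀ x ∈ N, ∀ m, MvPolynomial.homogeneousComponent m x ∈ N)
    {f : N →ₗ[SteenrodAlgebra p] N} (hf : IsDegreeZero (component p n N) f)
    {i : ℕ} (hi : i ≠ 0) {w : N} (hw : w ∈ component p n N i) (hfw : ∀ k, f^[k] w ≠ 0) :
    Set.BijOn f {x | (x : MvPolynomial (Fin n) (ZMod p)) ∈ augmentation p n}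
      {x | (x : MvPolynomial (Fin n) (ZMod p)) ∈ augmentation p n} := by
  rw [← coe_biSup_component_compl_zero hNle hN]
  exact hf.bijOn_biSup iSupIndep_component finite_component fun j hj x hx hfx =>
    eq_zero_of_apply_eq_zero hNle hf hi hw hfw hj hx hfx

theorem eq_C_of_mem_component_zero
    {N : Submodule (SteenrodAlgebra p) (MvPolynomial (Fin n) (ZMod p))} {x : N}
    (hx : x ∈ component p n N 0) : (x : MvPolynomial (Fin n) (ZMod p)) =
      MvPolynomial.C (MvPolynomial.constantCoeff (x : MvPolynomial (Fin n) (ZMod p))) :=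
  MvPolynomial.totalDegree_eq_zero_iff_eq_C.1 (Nat.le_zero.1
    ((isHomogeneous_of_mem_component hx).totalDegree_le.trans_eq (Nat.zero_div _)))

theorem bijective_iff_apply_one_ne_zero {f : dickson p n →ₗ[SteenrodAlgebra p] dickson p n}
    (hf : IsDegreeZero (component p n (dickson p n)) f)
    (hbij : Set.BijOn f {x | (x : MvPolynomial (Fin n) (ZMod p)) ∈ augmentation p n}
      {x | (x : MvPolynomial (Fin n) (ZMod p)) ∈ augmentation p n}) :
    Function.Bijective f ↔ f ⟨1, one_mem_dickson p n⟩ ≠ 0 := by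
  refine ⟨fun h h0 => one_ne_zero
    (congrArg Subtype.val (h.1 (h0.trans (map_zero f).symm))), fun h1 => ?_⟩
  have biSup_eq_top : (⨆ i ∈ Set.univ, component p n (dickson p n) i) = ⊤ := eq_top_iff.2
    fun x _ => mem_biSup_component (fun _ => homogeneousComponent_mem_dickson) fun _ _ => trivial
  have h := hf.bijOn_biSup (I := Set.univ) iSupIndep_component finite_component
    fun i _ x hx hfx => ?_
  · rwa [biSup_eq_top, Submodule.top_coe, Set.bijOn_univ] at h
  by_cases hi : i = 0
  · subst hi
    obtain ⟨c, rfl⟩ : ∃ c : ZMod p, x = c • (⟨1, one_mem_dickson p n⟩ : dickson p n) :=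
      ⟨_, Subtype.ext ((eq_C_of_mem_component_zero hx).trans MvPolynomial.C_eq_smul_one)⟩
    rw [LinearMap.map_smul_of_tower] at hfx
    rw [(smul_eq_zero.1 hfx).resolve_right h1, zero_smul]
  · exact hbij.injOn (mem_augmentation_of_mem_component le_rfl hi hx)
      (zero_mem (augmentation p n)) (hfx.trans (map_zero f).symm)

theorem bijective_of_iterate_apply_ne_zero
    {f : augmentation p n →ₗ[SteenrodAlgebra p] augmentation p n}
    (hf : IsDegreeZero (component p n (augmentation p n)) f) {i : ℕ} {w : augmentation p n}
    (hw : w ∈ component p n (augmentation p n) i) (hfw : ∀ k, f^[k] w ≠ 0) :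
    Function.Bijective f := by
  have hi : i ≠ 0 := by
    rintro rfl
    refine hfw 0 (Subtype.ext ?_)
    have h := eq_C_of_mem_component_zero hw
    rwa [w.2.2, map_zero] at h
  have h := bijOn_augmentation augmentation_le_dickson
    (fun _ => homogeneousComponent_mem_augmentation) hf hi hw hfw
  rwa [Set.eq_univ_of_forall (s := {x : augmentation p n | x.1 ∈ augmentation p n}) fun x => x.2,
    Set.bijOn_univ] at h

theorem exists_eq_smul_dicksonInvariant_one (hn : 1 ≤ n) {x : MvPolynomial (Fin n) (ZMod p)}
    (hx : x ∈ dickson p n) (hm : x.IsHomogeneous (p ^ n - p ^ (n - 1)))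
    (hd : dicksonInvariant p n 1 ≠ 0) : ∃ c : ZMod p, x = c • dicksonInvariant p n 1 := by
  have degree_pos : 0 < p ^ n - p ^ (n - 1) :=
    Nat.sub_pos_of_lt (Nat.pow_lt_pow_right (Fact.out : p.Prime).one_lt (by omega))
  let a₀ : Fin n → ZMod p := fun _ => 1
  have ha₀ : a₀ ≠ 0 := fun h => one_ne_zero (congrFun h ⟨0, hn⟩)
  have eq_zero_of_eval_eq_zero {y : MvPolynomial (Fin n) (ZMod p)} (hy : y ∈ invariants p n)
      (hym : y.IsHomogeneous (p ^ n - p ^ (n - 1))) (h0 : MvPolynomial.eval a₀ y = 0) :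
      y = 0 := by
    refine eq_zero_of_forall_eval_eq_zero hy hym ?_ fun a => ?_
    · rw [Nat.mul_sub, Nat.mul_sub, ← pow_succ', ← pow_succ', Nat.sub_add_cancel hn, mul_one,
        ← pow_succ]
    by_cases ha : a = 0
    · rw [ha, MvPolynomial.eval_zero, MvPolynomial.constantCoeff_eq]
      exact hym.coeff_eq_zero (by rw [map_zero]; exact degree_pos.ne)
    · rw [eval_eq_eval_of_ne_zero hy ha ha₀, h0]
  have hdm := dicksonInvariant_isHomogeneous (p := p) (n := n) 1
  have hev : MvPolynomial.eval a₀ (dicksonInvariant p n 1) ≠ 0 := fun h =>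
    hd (eq_zero_of_eval_eq_zero (dicksonInvariant_mem 1) hdm h)
  set c := MvPolynomial.eval a₀ x / MvPolynomial.eval a₀ (dicksonInvariant p n 1) with hc
  refine ⟨c, sub_eq_zero.1 (eq_zero_of_eval_eq_zero
    (sub_mem hx ((invariants p n).smul_mem (dicksonInvariant_mem 1) c)) (hm.sub ?_) ?_)⟩
  · rw [MvPolynomial.smul_eq_C_mul]
    exact hdm.C_mul c
  · rw [map_sub, MvPolynomial.smul_eval, hc, div_mul_cancel₀ _ hev, sub_self]

theorem degree_dicksonInvariant_one_ne_zero (hn : 1 ≤ n) :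
    genDegree p * (p ^ n - p ^ (n - 1)) ≠ 0 :=
  mul_ne_zero (genDegree_pos p).ne' (Nat.sub_pos_of_lt
    (Nat.pow_lt_pow_right (Fact.out : p.Prime).one_lt (by omega))).ne'

theorem iterate_apply_dicksonInvariant_one_ne_zero (hn : 1 ≤ n)
    {f : dickson p n →ₗ[SteenrodAlgebra p] dickson p n}
    (hf : IsDegreeZero (component p n (dickson p n)) f)
    (hfd : f ⟨dicksonInvariant p n 1, dicksonInvariant_mem 1⟩ ≠ 0) (k : ℕ) :
    f^[k] ⟨dicksonInvariant p n 1, dicksonInvariant_mem 1⟩ ≠ 0 := by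
  set d : dickson p n := ⟨dicksonInvariant p n 1, dicksonInvariant_mem 1⟩
  have d_ne_zero : d ≠ 0 := fun h => hfd (by rw [h, map_zero])
  have d_mem := mem_component_iff (N := dickson p n) (x := d).2 (dicksonInvariant_isHomogeneous 1)
  obtain ⟨c, hc⟩ := exists_eq_smul_dicksonInvariant_one hn (f d).2
    (mem_component_iff.1 (hf _ d d_mem)) fun h => d_ne_zero (Subtype.ext h)
  have apply_eq : f d = c • d := Subtype.ext hc
  have c_ne_zero : c ≠ 0 := fun h => hfd (by rw [apply_eq, h, zero_smul])
  have iterate_eq : f^[k] d = c ^ k • d := by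
    induction k with
    | zero => rw [Function.iterate_zero_apply, pow_zero, one_smul]
    | succ k ih =>
      rw [Function.iterate_succ_apply', ih, LinearMap.map_smul_of_tower, apply_eq, smul_smul,
        pow_succ]
  rw [iterate_eq]
  exact smul_ne_zero (pow_ne_zero k c_ne_zero) d_ne_zero

end Endomorphisms

end Dickson

theorem mainTheorem5_general (p : ℕ) [Fact p.Prime] (n : ℕ) :
    (∀ f : Dickson.dickson p n →ₗ[Dickson.SteenrodAlgebra p] Dickson.dickson p n,
      Dickson.IsDegreeZero (Dickson.component p n (Dickson.dickson p n)) f →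
      ∀ i ≠ 0, ∀ w ∈ Dickson.component p n (Dickson.dickson p n) i, (∀ k, f^[k] w ≠ 0) →
        Set.BijOn f {x | (x : MvPolynomial (Fin n) (ZMod p)) ∈ Dickson.augmentation p n}
          {x | (x : MvPolynomial (Fin n) (ZMod p)) ∈ Dickson.augmentation p n} ∧
        (Function.Bijective f ↔ f ⟨1, Dickson.one_mem_dickson p n⟩ ≠ 0)) ∧
    ∀ f : Dickson.augmentation p n →ₗ[Dickson.SteenrodAlgebra p] Dickson.augmentation p n,
      Dickson.IsDegreeZero (Dickson.component p n (Dickson.augmentation p n)) f →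
      ∀ i, ∀ w ∈ Dickson.component p n (Dickson.augmentation p n) i, (∀ k, f^[k] w ≠ 0) →
        Function.Bijective f := by
  refine ⟨fun f hf i hi w hw hfw => ?_, fun f hf i w hw hfw =>
    Dickson.bijective_of_iterate_apply_ne_zero hf hw hfw⟩
  have h := Dickson.bijOn_augmentation le_rfl (fun _ => Dickson.homogeneousComponent_mem_dickson)
    hf hi hw hfw
  exact ⟨h, Dickson.bijective_iff_apply_one_ne_zero hf h⟩

theorem mainTheorem5 (p : ℕ) [Fact p.Prime] (n : ℕ) (hn : 1 ≤ n) :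
    (∀ f : Dickson.dickson p n →ₗ[Dickson.SteenrodAlgebra p] Dickson.dickson p n,
      Dickson.IsDegreeZero (Dickson.component p n (Dickson.dickson p n)) f →
      f ⟨Dickson.dicksonInvariant p n 1, Dickson.dicksonInvariant_mem 1⟩ ≠ 0 →
        Set.BijOn f {x | (x : MvPolynomial (Fin n) (ZMod p)) ∈ Dickson.augmentation p n}
          {x | (x : MvPolynomial (Fin n) (ZMod p)) ∈ Dickson.augmentation p n} ∧
        (Function.Bijective f ↔ f ⟨1, Dickson.one_mem_dickson p n⟩ ≠ 0)) ∧
    Dickson.IsAtomic (Dickson.SteenrodAlgebra p)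
      (Dickson.component p n (Dickson.augmentation p n)) := by
  have ⟨restrict, bijective⟩ := mainTheorem5_general p n
  exact ⟨fun f hf hfd => restrict f hf _ (Dickson.degree_dicksonInvariant_one_ne_zero hn) _
    (Dickson.mem_component_iff.2 (Dickson.dicksonInvariant_isHomogeneous 1))
    (Dickson.iterate_apply_dicksonInvariant_one_ne_zero hn hf hfd),
    Dickson.isAtomic_of_forall_bijective bijective⟩
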